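/- Let $\Gamma\subset\mathbb R^3$ be a smooth closed surface (a compact smooth embedded two-dimensional submanifold with $\partial\Gamma=\emptyset$), with surface gradient $\nabla_\Gamma$, Laplace--Beltrami operator $\Delta_\Gamma$ and area measure $dA$ induced from $\mathbb R^3$. Let $\epsilon>0$, $b\in\mathbb R$, $T>0$, and let $u:[0,T]\times\Gamma\to\mathbb R$ be smooth (up to $t=0$ and $t=T$) and satisfy the modified Allen--Cahn equation $$u_t=\Delta_\Gamma u-\frac1{\epsilon^2}\,(u^3-u+b)\qquad\text{on }[0,T]\times\Gamma .$$ For $v:\Gamma\to\mathbb R$ put $$J^m_\epsilon(v)=\frac12\int_\Gamma|\nabla_\Gamma v|^2\,dA+\int_\Gamma\frac{F_m(v)}{\epsilon^2}\,dA,\qquad F_m(s)=\frac14(s^2-1)^2+b\,s .$$ Then for every $t\in[0,T]$ the functions $|\nabla_\Gamma u(t)|^2$, $F_m(u(t))/\epsilon^2$ and $u_t(t)^2$ are integrable on $\Gamma$, the function $t\mapsto J^m_\epsilon(u(t))$ is differentiable on $[0,T]$ (one-sidedly at the end points) with $$\frac{d}{dt}J^m_\epsilon(u(t))=-\int_\Gamma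 u_t(t)^2\,dA\le 0\qquad(t\in[0,T]),$$ and consequently $t\mapsto J^m_\epsilon(u(t))$ is nonincreasing on $[0,T]$. -/

import Mathlib

open scoped Manifold ContDiff
open MeasureTheory Set

noncomputable section

/-- The ambient Euclidean space `ℝ³`. -/
abbrev Space : Type := EuclideanSpace ℝ (Fin 3)

/-- The parameter plane `ℝ²`. -/
abbrev Plane : Type := EuclideanSpace ℝ (Fin 2)

/-- `Γ ⊂ ℝ³`, with its subspace topology and with a smooth atlas of charts in `ℝ²`, is a smooth
closed surface: it is compact, and the inclusion `Γ → ℝ³` is smooth with injective differential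
(so that it is a smooth embedding). Charts take values in the whole plane, so `∂Γ = ∅`. -/
structure IsClosedSurface (Γ : Set Space) [ChartedSpace Plane Γ] [IsManifold (𝓡 2) ∞ Γ] :
    Prop where
  isCompact : IsCompact Γ
  contMDiff_coe : ContMDiff (𝓡 2) 𝓘(ℝ, Space) ∞ (Subtype.val : Γ → Space)
  injective_mfderiv_coe :
    ∀ p : Γ, Function.Injective (mfderiv (𝓡 2) 𝓘(ℝ, Space) (Subtype.val : Γ → Space) p)

section Surface

variable {Γ : Set Space} [ChartedSpace Plane Γ]

/-- The differential at `p` of the inclusion `Γ → ℝ³`; its range is the tangent plane of `Γ`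
at `p`, as a plane in `ℝ³`. -/
def inclusionDeriv (p : Γ) : Plane →L[ℝ] Space :=
  mfderiv (𝓡 2) 𝓘(ℝ, Space) (Subtype.val : Γ → Space) p

/-- The differential at `p` of a function on `Γ`. -/
def scalarDeriv (v : Γ → ℝ) (p : Γ) : Plane →L[ℝ] ℝ :=
  mfderiv (𝓡 2) 𝓘(ℝ, ℝ) v p

/-- The surface (tangential) gradient `∇_Γ v (p) ∈ ℝ³`: with `L` the differential of the inclusion,
it is `L (L* L)⁻¹ (dv)♯`, that is, the unique vector `X` of the tangent plane `range L` such that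
`⟪X, L w⟫ = dv w` for all `w`. -/
def surfaceGradient (v : Γ → ℝ) (p : Γ) : Space :=
  inclusionDeriv p
    (((inclusionDeriv p).adjoint ∘L inclusionDeriv p).inverse
      ((InnerProductSpace.toDual ℝ Plane).symm (scalarDeriv v p)))

/-- The surface divergence of a field `X : Γ → ℝ³`: `div_Γ X = ∑ₖ (∇_Γ Xₖ)ₖ`, which is the trace
of `dX` over the tangent plane. -/
def surfaceDivergence (X : Γ → Space) (p : Γ) : ℝ :=
  ∑ k : Fin 3, surfaceGradient (fun q => X q k) p k

/-- The Laplace-Beltrami operator `Δ_Γ v = div_Γ ∇_Γ v`. -/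
def laplaceBeltrami (v : Γ → ℝ) (p : Γ) : ℝ :=
  surfaceDivergence (surfaceGradient v) p

/-- The area density `√det (Dφ* Dφ)` of the local parametrization `φ` of `Γ` that is inverse to
the preferred chart at `q`. Here `Dφ* Dφ` is the first fundamental form. -/
def areaDensity (q : Γ) (x : Plane) : ℝ :=
  let A : Plane →L[ℝ] Space :=
    fderiv ℝ (fun y : Plane => ((extChartAt (𝓡 2) q).symm y : Space)) x
  Real.sqrt (A.adjoint ∘L A).det

/-- The area measure of the domain of the preferred chart at `q`, extended by zero to `Γ`: in the
coordinates of the chart it is `√det (Dφ* Dφ) dx`. -/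
def chartArea (q : Γ) : Measure Γ :=
  ((volume.restrict (extChartAt (𝓡 2) q).target).withDensity
    (fun x => ENNReal.ofReal (areaDensity q x))).map (extChartAt (𝓡 2) q).symm

/-- The area measure `dA` of `Γ`. The local area measures agree on overlaps of chart domains, by
the change of variables formula, so that their supremum (as measures) is the measure on `Γ` which
restricts to `chartArea q` on the domain of the chart at `q`, for every `q`. -/
def areaMeasure (Γ : Set Space) [ChartedSpace Plane Γ] : Measure Γ :=
  ⨆ q : Γ, chartArea q

end Surface

/-- The reaction term `f_m(u) = u³ - u + b`. -/
def reaction (b s : ℝ) : ℝ := s ^ 3 - s + b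

/-- The potential `F_m(u) = (u² - 1)² / 4 + b u`. -/
def potential (b s : ℝ) : ℝ := 1 / 4 * (s ^ 2 - 1) ^ 2 + b * s

/-- The energy `J(v) = ½ ∫ |∇_Γ v|² dA + ∫ F_m(v) / ε² dA`. -/
def energy {Γ : Set Space} [ChartedSpace Plane Γ] (ε b : ℝ) (v : Γ → ℝ) : ℝ :=
  1 / 2 * ∫ p, ‖surfaceGradient v p‖ ^ 2 ∂(areaMeasure Γ) +
    ∫ p, potential b (v p) / ε ^ 2 ∂(areaMeasure Γ)

/-- The time derivative `u_t` of `u : [0, T] × Γ → ℝ` (one-sided at `t = 0` and `t = T`). -/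
def timeDeriv {Γ : Set Space} (T : ℝ) (u : ℝ → Γ → ℝ) (t : ℝ) (p : Γ) : ℝ :=
  derivWithin (fun s => u s p) (Icc 0 T) t

/-- `u` is smooth on `[0, T] × Γ` and satisfies there the modified Allen-Cahn equation
`u_t = Δ_Γ u - ε⁻² f_m(u)`. -/
structure IsSmoothSolution {Γ : Set Space} [ChartedSpace Plane Γ] (ε b T : ℝ) (u : ℝ → Γ → ℝ) :
    Prop where
  smooth : ContMDiffOn (𝓘(ℝ, ℝ).prod (𝓡 2)) 𝓘(ℝ, ℝ) ∞ (fun z : ℝ × Γ => u z.1 z.2)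
    (Icc 0 T ×ˢ univ)
  equation : ∀ t ∈ Icc 0 T, ∀ p : Γ,
    timeDeriv T u t p = laplaceBeltrami (u t) p - 1 / ε ^ 2 * reaction b (u t p)

end

/-! Formally, the derivative of the energy is the pairing of `u_t` with the first variation `-Δ_Γ u
+ f_m(u)/ε²`, which by the equation is `-u_t`. To avoid differentiating `∇_Γ u` in time, the proof
works with exact differences. Since `|∇v|² - |∇w|² = ∇(v - w) · ∇(v + w)`, Green's identity on a
surface without boundary gives `J(v) - J(w) = ∫ (v - w) R(v, w)` with `R = energySlope`
(`energy_sub_energy`). Hence the difference quotient of the energy is the integral of the difference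
quotient of `u` times `R(u(t), u(t₀))`. The equation expresses `Δ_Γ u` through `u_t` and `u`, so `R`
is jointly continuous in time and space, and on the diagonal it equals `-u_t`. Dominated convergence
concludes.

Green's identity (`integral_green`) is reduced by a partition of unity to one chart. There `√g Δ_Γ
f` is a plane divergence (`sqrt_gramDet_mul_sum_localGradient`), and divergences of compactly
supported fields integrate to zero. Passing to a chart rests on `areaMeasure_restrict_source`: the
local area measures agree on overlaps by change of variables, so their supremum restricts to each of
them. -/

/-! ### Partial derivatives in the plane. -/

section Calculus

variable {F : Type*} [NormedAddCommGroup F] [NormedSpace ℝ F]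

/-- The `i`-th partial derivative of a function on the plane. -/
noncomputable def partialDeriv (i : Fin 2) (h : Plane → F) (x : Plane) : F :=
  fderiv ℝ h x (EuclideanSpace.single i 1)

theorem fderiv_apply_eq_partialDeriv (h : Plane → F) (x w : Plane) :
    fderiv ℝ h x w = w 0 • partialDeriv 0 h x + w 1 • partialDeriv 1 h x := by
  have hw : w = w 0 • EuclideanSpace.single (0 : Fin 2) (1 : ℝ)
      + w 1 • EuclideanSpace.single (1 : Fin 2) (1 : ℝ) := by
    ext i; fin_cases i <;> simp
  conv_lhs => rw [hw]
  simp only [map_add, map_smul, partialDeriv]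

theorem ContDiffAt.partialDeriv {h : Plane → F} {x : Plane} (hh : ContDiffAt ℝ ∞ h x) (i : Fin 2) :
    ContDiffAt ℝ ∞ (partialDeriv i h) x :=
  (hh.fderiv_right (m := ∞) le_rfl).clm_apply contDiffAt_const

theorem ContDiffAt.partialDeriv_comm {h : Plane → F} {x : Plane} (hh : ContDiffAt ℝ ∞ h x)
    (i j : Fin 2) : _root_.partialDeriv i (_root_.partialDeriv j h) x
      = _root_.partialDeriv j (_root_.partialDeriv i h) x := by
  have hd : DifferentiableAt ℝ (fderiv ℝ h) x :=
    (hh.fderiv_right (m := ∞) le_rfl).differentiableAt (by simp)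
  have key (k : Fin 2) (w : Plane) : fderiv ℝ (_root_.partialDeriv k h) x w
      = fderiv ℝ (fderiv ℝ h) x w (EuclideanSpace.single k 1) := by
    have := (hd.hasFDerivAt.clm_apply (hasFDerivAt_const (EuclideanSpace.single k (1 : ℝ)) x)).fderiv
    unfold _root_.partialDeriv
    rw [this]; simp
  have hs : IsSymmSndFDerivAt ℝ h x := hh.isSymmSndFDerivAt (by
    rw [minSmoothness_of_isRCLikeNormedField]; exact ENat.LEInfty.out)
  conv_lhs => rw [_root_.partialDeriv, key]
  conv_rhs => rw [_root_.partialDeriv, key]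
  exact hs _ _

theorem partialDeriv_congr {h k : Plane → F} {x : Plane} (hk : h =ᶠ[nhds x] k) (i : Fin 2) :
    partialDeriv i h x = partialDeriv i k x := by
  rw [partialDeriv, partialDeriv, hk.fderiv_eq]

variable {x : Plane} (i : Fin 2)

theorem partialDeriv_add {h k : Plane → F} (hh : DifferentiableAt ℝ h x)
    (hk : DifferentiableAt ℝ k x) :
    partialDeriv i (fun y => h y + k y) x = partialDeriv i h x + partialDeriv i k x := by
  simp only [partialDeriv]
  rw [fderiv_fun_add hh hk]; rfl

theorem partialDeriv_sub {h k : Plane → F} (hh : DifferentiableAt ℝ h x)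
    (hk : DifferentiableAt ℝ k x) :
    partialDeriv i (fun y => h y - k y) x = partialDeriv i h x - partialDeriv i k x := by
  simp only [partialDeriv]
  rw [fderiv_fun_sub hh hk]; rfl

theorem partialDeriv_smul {h : Plane → ℝ} {k : Plane → F} (hh : DifferentiableAt ℝ h x)
    (hk : DifferentiableAt ℝ k x) :
    partialDeriv i (fun y => h y • k y) x = h x • partialDeriv i k x + partialDeriv i h x • k x := by
  simp only [partialDeriv]
  rw [fderiv_fun_smul hh hk]; rfl

theorem partialDeriv_mul {h k : Plane → ℝ} (hh : DifferentiableAt ℝ h x)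
    (hk : DifferentiableAt ℝ k x) :
    partialDeriv i (fun y => h y * k y) x = h x * partialDeriv i k x + partialDeriv i h x * k x :=
  partialDeriv_smul i hh hk

theorem partialDeriv_inner {h k : Plane → Space} (hh : DifferentiableAt ℝ h x)
    (hk : DifferentiableAt ℝ k x) :
    partialDeriv i (fun y => inner ℝ (h y) (k y)) x
      = inner ℝ (h x) (partialDeriv i k x) + inner ℝ (partialDeriv i h x) (k x) :=
  fderiv_inner_apply ℝ hh hk _

theorem partialDeriv_coord {h : Plane → Space} (hh : DifferentiableAt ℝ h x) (k : Fin 3) :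
    partialDeriv i (fun y => h y k) x = partialDeriv i h x k := by
  simp only [partialDeriv]
  have := ((EuclideanSpace.proj (𝕜 := ℝ) k : Space →L[ℝ] ℝ).hasFDerivAt.comp x hh.hasFDerivAt)
  rw [show (fun y => h y k) = (EuclideanSpace.proj (𝕜 := ℝ) k : Space →L[ℝ] ℝ) ∘ h from rfl,
    this.fderiv]; rfl

theorem partialDeriv_sqrt {h : Plane → ℝ} (hh : DifferentiableAt ℝ h x) (hx : h x ≠ 0) :
    partialDeriv i (fun y => Real.sqrt (h y)) x = partialDeriv i h x / (2 * Real.sqrt (h x)) := by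
  simp only [partialDeriv]
  rw [(hh.hasFDerivAt.sqrt hx).fderiv]; simp; ring

/-- A continuously differentiable function with compact support has partial derivatives of
integral zero. -/
theorem integral_partialDeriv_eq_zero {h : Plane → ℝ} (hh : ContDiff ℝ 1 h)
    (hc : HasCompactSupport h) : ∫ x, partialDeriv i h x = 0 := by
  have hd : Continuous (partialDeriv i h) :=
    (hh.continuous_fderiv (by simp)).clm_apply continuous_const
  have hdc : HasCompactSupport (partialDeriv i h) :=
    (hc.fderiv ℝ).comp_left
      (g := fun L : Plane →L[ℝ] ℝ => L (EuclideanSpace.single i (1:ℝ))) (by simp)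
  -- Integration by parts against the constant function 1, whose derivative vanishes.
  have := integral_mul_fderiv_eq_neg_fderiv_mul_of_integrable (μ := (volume : Measure Plane))
    (𝕜 := ℝ) (f := fun _ => (1:ℝ)) (g := h) (v := EuclideanSpace.single i (1:ℝ))
    (by simp) (by simp only [one_mul]; exact hd.integrable_of_hasCompactSupport hdc)
    (by simp only [one_mul]; exact hh.continuous.integrable_of_hasCompactSupport hc)
    (fun _ _ => by fun_prop) (fun x _ => hh.differentiable (by simp) x)
  simpa [partialDeriv] using this

end Calculus

/-! ### First fundamental form, gradient and divergence of a parametrized surface. -/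

section LocalGeometry

/-- The entries of the first fundamental form of a parametrization `φ`. -/
noncomputable def gram (φ : Plane → Space) (i j : Fin 2) (x : Plane) : ℝ :=
  inner ℝ (partialDeriv i φ x) (partialDeriv j φ x)

/-- The determinant of the first fundamental form. -/
noncomputable def gramDet (φ : Plane → Space) (x : Plane) : ℝ :=
  gram φ 0 0 x * gram φ 1 1 x - gram φ 0 1 x * gram φ 0 1 x

/-- The coordinates of the surface gradient in the frame of a parametrization `φ`. -/
noncomputable def gradCoord (φ : Plane → Space) (f : Plane → ℝ) (i : Fin 2) (x : Plane) : ℝ :=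
  (gram φ (1 - i) (1 - i) x * partialDeriv i f x - gram φ 0 1 x * partialDeriv (1 - i) f x)
    / gramDet φ x

/-- The surface gradient in a parametrization `φ`. -/
noncomputable def localGradient (φ : Plane → Space) (f : Plane → ℝ) (x : Plane) : Space :=
  gradCoord φ f 0 x • partialDeriv 0 φ x + gradCoord φ f 1 x • partialDeriv 1 φ x

variable {φ : Plane → Space} {f h : Plane → ℝ} {x : Plane}

theorem contDiffAt_gram (hφ : ContDiffAt ℝ ∞ φ x) (i j : Fin 2) :
    ContDiffAt ℝ ∞ (gram φ i j) x :=
  (hφ.partialDeriv i).inner ℝ (hφ.partialDeriv j)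

theorem contDiffAt_gramDet (hφ : ContDiffAt ℝ ∞ φ x) : ContDiffAt ℝ ∞ (gramDet φ) x :=
  ((contDiffAt_gram hφ 0 0).mul (contDiffAt_gram hφ 1 1)).sub
    ((contDiffAt_gram hφ 0 1).mul (contDiffAt_gram hφ 0 1))

theorem contDiffAt_gradCoord (hφ : ContDiffAt ℝ ∞ φ x) (hf : ContDiffAt ℝ ∞ f x)
    (hg : gramDet φ x ≠ 0) (i : Fin 2) : ContDiffAt ℝ ∞ (gradCoord φ f i) x :=
  (((contDiffAt_gram hφ _ _).mul (hf.partialDeriv i)).sub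
    ((contDiffAt_gram hφ _ _).mul (hf.partialDeriv _))).div (contDiffAt_gramDet hφ) hg

theorem contDiffAt_localGradient (hφ : ContDiffAt ℝ ∞ φ x) (hf : ContDiffAt ℝ ∞ f x)
    (hg : gramDet φ x ≠ 0) : ContDiffAt ℝ ∞ (localGradient φ f) x :=
  ((contDiffAt_gradCoord hφ hf hg 0).smul (hφ.partialDeriv 0)).add
    ((contDiffAt_gradCoord hφ hf hg 1).smul (hφ.partialDeriv 1))

/-- Cramer's rule: in `Fin 2`, `1 - i` is the index other than `i`, so `gradCoord` is the inverse
Gram matrix applied to the partial derivatives of `f`. -/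
theorem inner_localGradient_partialDeriv (hg : gramDet φ x ≠ 0) (i : Fin 2) :
    inner ℝ (localGradient φ f x) (partialDeriv i φ x) = partialDeriv i f x := by
  have hc : inner ℝ (partialDeriv 1 φ x) (partialDeriv 0 φ x) = gram φ 0 1 x :=
    real_inner_comm _ _
  have h00 : inner ℝ (partialDeriv 0 φ x) (partialDeriv 0 φ x) = gram φ 0 0 x := rfl
  have h01 : inner ℝ (partialDeriv 0 φ x) (partialDeriv 1 φ x) = gram φ 0 1 x := rfl
  have h11 : inner ℝ (partialDeriv 1 φ x) (partialDeriv 1 φ x) = gram φ 1 1 x := rfl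
  have hd : gramDet φ x = gram φ 0 0 x * gram φ 1 1 x - gram φ 0 1 x * gram φ 0 1 x := rfl
  fin_cases i
  · simp only [localGradient, inner_add_left, inner_smul_left, gradCoord, Fin.zero_eta, hc, h00,
      conj_trivial, sub_zero, sub_self]
    field_simp
    linear_combination -partialDeriv 0 f x * hd
  · simp only [localGradient, inner_add_left, inner_smul_left, gradCoord, Fin.mk_one, h01, h11,
      conj_trivial, sub_zero, sub_self]
    field_simp
    linear_combination -partialDeriv 1 f x * hd

theorem inner_localGradient_localGradient (hg : gramDet φ x ≠ 0) :
    inner ℝ (localGradient φ f x) (localGradient φ h x)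
      = gradCoord φ f 0 x * partialDeriv 0 h x + gradCoord φ f 1 x * partialDeriv 1 h x := by
  conv_lhs => rw [localGradient]
  rw [inner_add_left, inner_smul_left, inner_smul_left, real_inner_comm,
    inner_localGradient_partialDeriv hg, real_inner_comm, inner_localGradient_partialDeriv hg]
  simp

/-- In local coordinates, the surface divergence of a gradient is the divergence of its coordinate
field, weighted by the area density. -/
theorem sqrt_gramDet_mul_sum_localGradient (hφ : ContDiffAt ℝ ∞ φ x) (hf : ContDiffAt ℝ ∞ f x)
    (hg : 0 < gramDet φ x) :
    Real.sqrt (gramDet φ x) *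
        ∑ k : Fin 3, localGradient φ (fun y => localGradient φ f y k) x k
      = partialDeriv 0 (fun y => Real.sqrt (gramDet φ y) * gradCoord φ f 0 y) x
        + partialDeriv 1 (fun y => Real.sqrt (gramDet φ y) * gradCoord φ f 1 y) x := by
  have d {F : Type} [NormedAddCommGroup F] [NormedSpace ℝ F] {h : Plane → F}
    (hh : ContDiffAt ℝ ∞ h x) : DifferentiableAt ℝ h x := hh.differentiableAt (by simp)
  have hφ0 := d (hφ.partialDeriv 0)
  have hφ1 := d (hφ.partialDeriv 1)
  have hc0 := d (contDiffAt_gradCoord hφ hf hg.ne' 0)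
  have hc1 := d (contDiffAt_gradCoord hφ hf hg.ne' 1)
  have hY := d (contDiffAt_localGradient hφ hf hg.ne')
  have hE := d (contDiffAt_gram hφ 0 0)
  have hF := d (contDiffAt_gram hφ 0 1)
  have hG := d (contDiffAt_gram hφ 1 1)
  have hD := d (contDiffAt_gramDet hφ)
  have hs : DifferentiableAt ℝ (fun y => Real.sqrt (gramDet φ y)) x := hD.sqrt hg.ne'
  -- With `Y` the local gradient, the sum over the ambient coordinates is the trace `g^{ij} ⟪∂ᵢY,
  -- ∂ⱼφ⟫`.
  have hsum : ∑ k : Fin 3, localGradient φ (fun y => localGradient φ f y k) x k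
      = ((gram φ 1 1 x * inner ℝ (partialDeriv 0 (localGradient φ f) x) (partialDeriv 0 φ x)
          - gram φ 0 1 x * inner ℝ (partialDeriv 1 (localGradient φ f) x) (partialDeriv 0 φ x))
        + (gram φ 0 0 x * inner ℝ (partialDeriv 1 (localGradient φ f) x) (partialDeriv 1 φ x)
          - gram φ 0 1 x * inner ℝ (partialDeriv 0 (localGradient φ f) x) (partialDeriv 1 φ x)))
        / gramDet φ x := by
    have e (k : Fin 3) : localGradient φ (fun y => localGradient φ f y k) x k
      = ((gram φ 1 1 x * partialDeriv 0 (localGradient φ f) x k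
          - gram φ 0 1 x * partialDeriv 1 (localGradient φ f) x k) * partialDeriv 0 φ x k
        + (gram φ 0 0 x * partialDeriv 1 (localGradient φ f) x k
          - gram φ 0 1 x * partialDeriv 0 (localGradient φ f) x k) * partialDeriv 1 φ x k)
          / gramDet φ x := by
      conv_lhs => rw [localGradient]
      simp only [gradCoord, partialDeriv_coord _ hY, PiLp.add_apply, PiLp.smul_apply, smul_eq_mul]
      simp only [sub_zero, sub_self]
      ring
    simp only [e, ← Finset.sum_div]
    congr 1
    simp only [PiLp.inner_apply, Fin.sum_univ_three, RCLike.inner_apply, conj_trivial]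
    ring
  have hYi (i : Fin 2) : partialDeriv i (localGradient φ f) x
      = (gradCoord φ f 0 x • partialDeriv i (partialDeriv 0 φ) x
          + partialDeriv i (gradCoord φ f 0) x • partialDeriv 0 φ x)
        + (gradCoord φ f 1 x • partialDeriv i (partialDeriv 1 φ) x
          + partialDeriv i (gradCoord φ f 1) x • partialDeriv 1 φ x) := by
    rw [← partialDeriv_smul i hc0 hφ0, ← partialDeriv_smul i hc1 hφ1,
      ← partialDeriv_add i (hc0.fun_smul hφ0) (hc1.fun_smul hφ1)]
    rfl
  have hDi (i : Fin 2) : partialDeriv i (gramDet φ) x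
      = (gram φ 0 0 x * partialDeriv i (gram φ 1 1) x + partialDeriv i (gram φ 0 0) x * gram φ 1 1 x)
      - (gram φ 0 1 x * partialDeriv i (gram φ 0 1) x
        + partialDeriv i (gram φ 0 1) x * gram φ 0 1 x) := by
    rw [← partialDeriv_mul i hE hG, ← partialDeriv_mul i hF hF,
      ← partialDeriv_sub i (hE.fun_mul hG) (hF.fun_mul hF)]
    rfl
  have hEi (i : Fin 2) : partialDeriv i (gram φ 0 0) x = _ := partialDeriv_inner i hφ0 hφ0
  have hFi (i : Fin 2) : partialDeriv i (gram φ 0 1) x = _ := partialDeriv_inner i hφ0 hφ1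
  have hGi (i : Fin 2) : partialDeriv i (gram φ 1 1) x = _ := partialDeriv_inner i hφ1 hφ1
  rw [hsum, partialDeriv_mul 0 hs hc0, partialDeriv_mul 1 hs hc1, partialDeriv_sqrt 0 hD hg.ne',
    partialDeriv_sqrt 1 hD hg.ne', hDi, hDi, hEi, hEi, hFi, hFi, hGi, hGi, hYi, hYi,
    hφ.partialDeriv_comm 1 0]
  have hsp : 0 < Real.sqrt (gramDet φ x) := Real.sqrt_pos.2 hg
  have hss : gramDet φ x = Real.sqrt (gramDet φ x) ^ 2 := (Real.sq_sqrt hg.le).symm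
  set s := Real.sqrt (gramDet φ x) with hsdef
  simp only [inner_add_left, inner_smul_left, conj_trivial]
  have hba : inner ℝ (partialDeriv 1 φ x) (partialDeriv 0 φ x) = gram φ 0 1 x :=
    real_inner_comm _ _
  have h00 : inner ℝ (partialDeriv 0 φ x) (partialDeriv 0 φ x) = gram φ 0 0 x := rfl
  have h01 : inner ℝ (partialDeriv 0 φ x) (partialDeriv 1 φ x) = gram φ 0 1 x := rfl
  have h11 : inner ℝ (partialDeriv 1 φ x) (partialDeriv 1 φ x) = gram φ 1 1 x := rfl
  simp only [hba, h00, h01, h11]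
  have hcm (i j : Fin 2) (k : Fin 2) :
      inner ℝ (partialDeriv k φ x) (partialDeriv i (partialDeriv j φ) x)
        = inner ℝ (partialDeriv i (partialDeriv j φ) x) (partialDeriv k φ x) :=
    real_inner_comm _ _
  simp only [hcm]
  have hgd : gram φ 0 0 x * gram φ 1 1 x = s ^ 2 + gram φ 0 1 x * gram φ 0 1 x := by
    rw [← hss, gramDet]; ring
  rw [hss]
  field_simp
  -- The coordinates `gradCoord` are kept as atoms: the identity holds for any tangential field.
  -- Once mixed partials are exchanged, the second derivatives of `φ` cancel, and only `EG - F² =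
  -- s²` is needed for the rest.
  linear_combination 2 * (partialDeriv 0 (gradCoord φ f 0) x
    + partialDeriv 1 (gradCoord φ f 1) x) * hgd

end LocalGeometry

/-! ### The surface operators in the coordinates of a chart. -/

section Charts

variable {Γ : Set Space} [ChartedSpace Plane Γ]

/-- The local parametrization of a surface which is inverse to the preferred chart at `q`. -/
noncomputable def param (q : Γ) (y : Plane) : Space := ((extChartAt (𝓡 2) q).symm y : Space)

/-- In the standard basis the matrix of `A* A` has entries `⟪A eᵢ, A eⱼ⟫`. This identifies
`areaDensity` with `√gramDet`. -/
theorem det_adjoint_comp_self (A : Plane →L[ℝ] Space) :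
    (A.adjoint ∘L A).det
      = inner ℝ (A (EuclideanSpace.single 0 1)) (A (EuclideanSpace.single 0 1))
        * inner ℝ (A (EuclideanSpace.single 1 1)) (A (EuclideanSpace.single 1 1))
      - inner ℝ (A (EuclideanSpace.single 0 1)) (A (EuclideanSpace.single 1 1))
        * inner ℝ (A (EuclideanSpace.single 0 1)) (A (EuclideanSpace.single 1 1)) := by
  have hB (B : OrthonormalBasis (Fin 2) ℝ Plane) (i j : Fin 2) :
      LinearMap.toMatrix B.toBasis B.toBasis
        ((A.adjoint ∘L A : Plane →L[ℝ] Plane) : Plane →ₗ[ℝ] Plane) i j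
      = inner ℝ (A (B i)) (A (B j)) := by
    rw [LinearMap.toMatrix_apply, OrthonormalBasis.coe_toBasis_repr_apply,
      OrthonormalBasis.repr_apply_apply, OrthonormalBasis.coe_toBasis,
      ← ContinuousLinearMap.adjoint_inner_right]
    rfl
  rw [ContinuousLinearMap.det,
    ← LinearMap.det_toMatrix (EuclideanSpace.basisFun (Fin 2) ℝ).toBasis, Matrix.det_fin_two,
    hB, hB, hB, hB, EuclideanSpace.basisFun_apply, EuclideanSpace.basisFun_apply]
  rw [real_inner_comm (A (EuclideanSpace.single 0 1)) (A (EuclideanSpace.single 1 1))]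

theorem areaDensity_eq_sqrt_gramDet (q : Γ) (y : Plane) :
    areaDensity q y = Real.sqrt (gramDet (param q) y) := by
  change Real.sqrt (((fderiv ℝ (param q) y).adjoint ∘L fderiv ℝ (param q) y).det) = _
  rw [det_adjoint_comp_self]
  rfl

theorem extChartAt_target_mem_nhds_of_mem {q : Γ} {y : Plane}
    (hy : y ∈ (extChartAt (𝓡 2) q).target) :
    (extChartAt (𝓡 2) q).target ∈ nhds y :=
  (isOpen_extChartAt_target q).mem_nhds hy

variable [IsManifold (𝓡 2) ∞ Γ] {F : Type*} [NormedAddCommGroup F] [NormedSpace ℝ F]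

theorem ContMDiff.contDiffAt_comp_extChartAt_symm {h : Γ → F} (hh : ContMDiff (𝓡 2) 𝓘(ℝ, F) ∞ h)
    {q : Γ} {y : Plane} (hy : y ∈ (extChartAt (𝓡 2) q).target) :
    ContDiffAt ℝ ∞ (fun z => h ((extChartAt (𝓡 2) q).symm z)) y :=
  (hh.comp_contMDiffOn (contMDiffOn_extChartAt_symm q)).contDiffOn.contDiffAt
    (extChartAt_target_mem_nhds_of_mem hy)

theorem contDiffAt_param (hΓ : IsClosedSurface Γ) {q : Γ} {y : Plane}
    (hy : y ∈ (extChartAt (𝓡 2) q).target) : ContDiffAt ℝ ∞ (param q) y :=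
  hΓ.contMDiff_coe.contDiffAt_comp_extChartAt_symm hy

/-- Chain rule for `h = (h ∘ chart⁻¹) ∘ chart`. The manifold derivative at a point refers to the
preferred chart of that point, not to the one at `q`, hence the extra factor. It appears in both
`inclusionDeriv` and `scalarDeriv` and drops out of the gradient. -/
theorem hasMFDerivAt_extChartAt_symm {q : Γ} {y : Plane}
    (hy : y ∈ (extChartAt (𝓡 2) q).target) {h : Γ → F}
    (hh : DifferentiableAt ℝ (fun z => h ((extChartAt (𝓡 2) q).symm z)) y) :
    HasMFDerivAt (𝓡 2) 𝓘(ℝ, F) h ((extChartAt (𝓡 2) q).symm y)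
      ((fderiv ℝ (fun z => h ((extChartAt (𝓡 2) q).symm z)) y : Plane →L[ℝ] F) ∘L
        (mfderiv (𝓡 2) 𝓘(ℝ, Plane) (extChartAt (𝓡 2) q) ((extChartAt (𝓡 2) q).symm y) :
          Plane →L[ℝ] Plane)) := by
  have hs : (extChartAt (𝓡 2) q).symm y ∈ (extChartAt (𝓡 2) q).source :=
    (extChartAt (𝓡 2) q).map_target hy
  have hs' := hs
  rw [extChartAt_source] at hs'
  have h1 : HasMFDerivAt (𝓡 2) 𝓘(ℝ, Plane) (extChartAt (𝓡 2) q) ((extChartAt (𝓡 2) q).symm y) _ :=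
    (mdifferentiableAt_extChartAt hs').hasMFDerivAt
  have h2 : HasMFDerivAt 𝓘(ℝ, Plane) 𝓘(ℝ, F) (fun z => h ((extChartAt (𝓡 2) q).symm z))
      (extChartAt (𝓡 2) q ((extChartAt (𝓡 2) q).symm y))
      (fderiv ℝ (fun z => h ((extChartAt (𝓡 2) q).symm z)) y) := by
    rw [(extChartAt (𝓡 2) q).right_inv hy]
    exact hh.hasFDerivAt.hasMFDerivAt
  refine (h2.comp _ h1).congr_of_eventuallyEq ?_
  filter_upwards [extChartAt_source_mem_nhds' hs] with p hp
  exact congrArg h ((extChartAt (𝓡 2) q).left_inv hp).symm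

/-- The differential of the chart at `q`, at the point with coordinates `y`. -/
noncomputable def chartDeriv (q : Γ) (y : Plane) : Plane →L[ℝ] Plane :=
  mfderiv (𝓡 2) 𝓘(ℝ, Plane) (extChartAt (𝓡 2) q) ((extChartAt (𝓡 2) q).symm y)

theorem bijective_chartDeriv {q : Γ} {y : Plane} (hy : y ∈ (extChartAt (𝓡 2) q).target) :
    Function.Bijective (chartDeriv q y) :=
  (isInvertible_mfderiv_extChartAt ((extChartAt (𝓡 2) q).map_target hy)).bijective

theorem inclusionDeriv_extChartAt_symm (hΓ : IsClosedSurface Γ) {q : Γ} {y : Plane}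
    (hy : y ∈ (extChartAt (𝓡 2) q).target) :
    inclusionDeriv ((extChartAt (𝓡 2) q).symm y) = fderiv ℝ (param q) y ∘L chartDeriv q y :=
  (hasMFDerivAt_extChartAt_symm hy
    ((contDiffAt_param hΓ hy).differentiableAt (by simp))).mfderiv

theorem scalarDeriv_extChartAt_symm {q : Γ} {y : Plane}
    (hy : y ∈ (extChartAt (𝓡 2) q).target) {v : Γ → ℝ}
    (hv : DifferentiableAt ℝ (fun z => v ((extChartAt (𝓡 2) q).symm z)) y) :
    scalarDeriv v ((extChartAt (𝓡 2) q).symm y)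
      = fderiv ℝ (fun z => v ((extChartAt (𝓡 2) q).symm z)) y ∘L chartDeriv q y :=
  (hasMFDerivAt_extChartAt_symm hy hv).mfderiv

theorem injective_fderiv_param (hΓ : IsClosedSurface Γ) {q : Γ} {y : Plane}
    (hy : y ∈ (extChartAt (𝓡 2) q).target) : Function.Injective (fderiv ℝ (param q) y) := by
  have h1 : Function.Injective (inclusionDeriv ((extChartAt (𝓡 2) q).symm y)) :=
    hΓ.injective_mfderiv_coe _
  rw [inclusionDeriv_extChartAt_symm hΓ hy] at h1
  intro a b hab
  obtain ⟨a, rfl⟩ := (bijective_chartDeriv hy).2 a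
  obtain ⟨b, rfl⟩ := (bijective_chartDeriv hy).2 b
  rw [h1 hab]

/-- Strict Cauchy-Schwarz for the two partial derivatives, which are linearly independent because
the differential is injective. -/
theorem gramDet_pos_of_injective {φ : Plane → Space} {x : Plane}
    (h : Function.Injective (fderiv ℝ φ x)) : 0 < gramDet φ x := by
  have hli : LinearIndependent ℝ ![partialDeriv 0 φ x, partialDeriv 1 φ x] := by
    rw [LinearIndependent.pair_iff]
    intro s t hst
    have h0 : fderiv ℝ φ x (!₂[s, t]) = fderiv ℝ φ x 0 := by
      rw [fderiv_apply_eq_partialDeriv, map_zero]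
      simpa using hst
    have h1 := h h0
    exact ⟨by simpa using congrArg (fun w : Plane => w 0) h1,
      by simpa using congrArg (fun w : Plane => w 1) h1⟩
  have hcs : inner ℝ (partialDeriv 0 φ x) (partialDeriv 1 φ x)
      * inner ℝ (partialDeriv 0 φ x) (partialDeriv 1 φ x)
      < inner ℝ (partialDeriv 0 φ x) (partialDeriv 0 φ x)
        * inner ℝ (partialDeriv 1 φ x) (partialDeriv 1 φ x) := by
    rw [real_inner_self_eq_norm_sq, real_inner_self_eq_norm_sq]
    have h1 := abs_real_inner_le_norm (partialDeriv 0 φ x) (partialDeriv 1 φ x)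
    have h2 : |inner ℝ (partialDeriv 0 φ x) (partialDeriv 1 φ x)|
        ≠ ‖partialDeriv 0 φ x‖ * ‖partialDeriv 1 φ x‖ := by
      intro he
      have hne0 : partialDeriv 0 φ x ≠ 0 := hli.ne_zero 0
      have hne1 : partialDeriv 1 φ x ≠ 0 := hli.ne_zero 1
      have := (norm_inner_eq_norm_iff (𝕜 := ℝ) hne0 hne1).1 he
      obtain ⟨r, -, hr⟩ := this
      have := (LinearIndependent.pair_iff.1 hli) r (-1) (by rw [hr]; simp)
      simp at this
    have h3 := lt_of_le_of_ne h1 h2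
    calc _ = |inner ℝ (partialDeriv 0 φ x) (partialDeriv 1 φ x)| ^ 2 := by rw [sq_abs]; ring
      _ < (‖partialDeriv 0 φ x‖ * ‖partialDeriv 1 φ x‖) ^ 2 := by gcongr
      _ = _ := by ring
  exact sub_pos.2 hcs

theorem gramDet_param_pos (hΓ : IsClosedSurface Γ) {q : Γ} {y : Plane}
    (hy : y ∈ (extChartAt (𝓡 2) q).target) : 0 < gramDet (param q) y :=
  gramDet_pos_of_injective (injective_fderiv_param hΓ hy)

/-- `⟪L* L w, w⟫ = ‖L w‖²` makes the kernel trivial. Since `inverse` is 0 on non-invertible maps,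
`surfaceGradient` has its intended meaning only through this fact. -/
theorem isInvertible_adjoint_comp_self {L : Plane →L[ℝ] Space} (hL : Function.Injective L) :
    (L.adjoint ∘L L).IsInvertible := by
  have hinj : Function.Injective ((L.adjoint ∘L L : Plane →L[ℝ] Plane) : Plane →ₗ[ℝ] Plane) := by
    rw [← LinearMap.ker_eq_bot, LinearMap.ker_eq_bot']
    intro w hw
    apply hL
    rw [map_zero, ← inner_self_eq_zero (𝕜 := ℝ), ← ContinuousLinearMap.adjoint_inner_left]
    have : L.adjoint (L w) = 0 := hw
    rw [this, inner_zero_left]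
  exact ⟨(LinearEquiv.ofInjectiveEndo _ hinj).toContinuousLinearEquiv, by ext1 w; rfl⟩

/-- The surface gradient is characterized as the tangent vector which represents the
differential. -/
theorem surfaceGradient_eq_of_inner (hΓ : IsClosedSurface Γ) {v : Γ → ℝ} {p : Γ} {w : Plane}
    (h : ∀ z, inner ℝ (inclusionDeriv p w) (inclusionDeriv p z) = scalarDeriv v p z) :
    surfaceGradient v p = inclusionDeriv p w := by
  have hinv := isInvertible_adjoint_comp_self
    (show Function.Injective (inclusionDeriv p) from hΓ.injective_mfderiv_coe p)
  have hw : (InnerProductSpace.toDual ℝ Plane).symm (scalarDeriv v p)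
      = ((inclusionDeriv p).adjoint ∘L inclusionDeriv p) w := by
    rw [LinearIsometryEquiv.symm_apply_eq]
    ext z
    rw [InnerProductSpace.toDual_apply_apply, ← h z, ContinuousLinearMap.comp_apply,
      ContinuousLinearMap.adjoint_inner_left]
  rw [surfaceGradient, hw, hinv.inverse_apply_self]

/-- The surface gradient in the coordinates of a chart. -/
theorem surfaceGradient_extChartAt_symm (hΓ : IsClosedSurface Γ) {q : Γ} {y : Plane}
    (hy : y ∈ (extChartAt (𝓡 2) q).target) {v : Γ → ℝ}
    (hv : DifferentiableAt ℝ (fun z => v ((extChartAt (𝓡 2) q).symm z)) y) :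
    surfaceGradient v ((extChartAt (𝓡 2) q).symm y)
      = localGradient (param q) (fun z => v ((extChartAt (𝓡 2) q).symm z)) y := by
  set f : Plane → ℝ := fun z => v ((extChartAt (𝓡 2) q).symm z) with hf
  obtain ⟨w, hw⟩ := (bijective_chartDeriv hy).2
    (!₂[gradCoord (param q) f 0 y, gradCoord (param q) f 1 y])
  have hL : inclusionDeriv ((extChartAt (𝓡 2) q).symm y) w = localGradient (param q) f y := by
    rw [inclusionDeriv_extChartAt_symm hΓ hy, ContinuousLinearMap.comp_apply, hw,
      fderiv_apply_eq_partialDeriv]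
    simp [localGradient]
  rw [← hL]
  refine surfaceGradient_eq_of_inner hΓ fun z => ?_
  rw [hL, inclusionDeriv_extChartAt_symm hΓ hy, scalarDeriv_extChartAt_symm hy hv,
    ContinuousLinearMap.comp_apply, ContinuousLinearMap.comp_apply, fderiv_apply_eq_partialDeriv,
    fderiv_apply_eq_partialDeriv, inner_add_right, inner_smul_right, inner_smul_right,
    inner_localGradient_partialDeriv (gramDet_param_pos hΓ hy).ne',
    inner_localGradient_partialDeriv (gramDet_param_pos hΓ hy).ne']
  rfl

theorem surfaceGradient_extChartAt_symm_of_contMDiff (hΓ : IsClosedSurface Γ) {q : Γ} {y : Plane}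
    (hy : y ∈ (extChartAt (𝓡 2) q).target) {v : Γ → ℝ} (hv : ContMDiff (𝓡 2) 𝓘(ℝ, ℝ) ∞ v) :
    surfaceGradient v ((extChartAt (𝓡 2) q).symm y)
      = localGradient (param q) (fun z => v ((extChartAt (𝓡 2) q).symm z)) y :=
  surfaceGradient_extChartAt_symm hΓ hy
    ((hv.contDiffAt_comp_extChartAt_symm hy).differentiableAt (by simp))

theorem laplaceBeltrami_extChartAt_symm (hΓ : IsClosedSurface Γ) {q : Γ} {y : Plane}
    (hy : y ∈ (extChartAt (𝓡 2) q).target) {v : Γ → ℝ} (hv : ContMDiff (𝓡 2) 𝓘(ℝ, ℝ) ∞ v) :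
    laplaceBeltrami v ((extChartAt (𝓡 2) q).symm y)
      = ∑ k : Fin 3, localGradient (param q) (fun z => localGradient (param q)
          (fun z => v ((extChartAt (𝓡 2) q).symm z)) z k) y k := by
  set f : Plane → ℝ := fun z => v ((extChartAt (𝓡 2) q).symm z) with hf
  rw [laplaceBeltrami, surfaceDivergence]
  refine Finset.sum_congr rfl fun k _ => ?_
  -- The coordinate formula for the gradient holds only on the chart target. Agreement near `y`
  -- suffices, as the outer gradient depends only on the germ.
  have he : (fun z => surfaceGradient v ((extChartAt (𝓡 2) q).symm z) k)
      =ᶠ[nhds y] fun z => localGradient (param q) f z k := by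
    filter_upwards [extChartAt_target_mem_nhds_of_mem hy] with z hz
    rw [surfaceGradient_extChartAt_symm_of_contMDiff hΓ hz hv]
  have hd : DifferentiableAt ℝ (fun z => localGradient (param q) f z k) y := by
    have := (contDiffAt_localGradient (contDiffAt_param hΓ hy)
      (hv.contDiffAt_comp_extChartAt_symm hy) (gramDet_param_pos hΓ hy).ne').differentiableAt
        (by simp)
    exact (EuclideanSpace.proj (𝕜 := ℝ) k : Space →L[ℝ] ℝ).differentiableAt.comp y this
  rw [surfaceGradient_extChartAt_symm hΓ hy (hd.congr_of_eventuallyEq he)]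
  simp only [localGradient, gradCoord, partialDeriv_congr he]

theorem continuous_surfaceGradient (hΓ : IsClosedSurface Γ) {v : Γ → ℝ}
    (hv : ContMDiff (𝓡 2) 𝓘(ℝ, ℝ) ∞ v) : Continuous (surfaceGradient v) := by
  rw [continuous_iff_continuousAt]
  intro p
  have hy := mem_extChartAt_target (I := 𝓡 2) p
  have h1 : ContinuousAt (fun r : Γ => localGradient (param p)
      (fun z => v ((extChartAt (𝓡 2) p).symm z)) (extChartAt (𝓡 2) p r)) p :=
    ContinuousAt.comp (g := localGradient (param p) (fun z => v ((extChartAt (𝓡 2) p).symm z)))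
      (contDiffAt_localGradient (contDiffAt_param hΓ hy)
        (hv.contDiffAt_comp_extChartAt_symm hy) (gramDet_param_pos hΓ hy).ne').continuousAt
      (continuousAt_extChartAt p)
  refine h1.congr ?_
  filter_upwards [extChartAt_source_mem_nhds (I := 𝓡 2) p] with r hr
  rw [← surfaceGradient_extChartAt_symm_of_contMDiff hΓ ((extChartAt (𝓡 2) p).map_source hr) hv,
    (extChartAt (𝓡 2) p).left_inv hr]

end Charts

/-! ### The area measure. -/

section Area

variable {Γ : Set Space} [ChartedSpace Plane Γ]

/-- The inverse chart is controlled only on its target, and `Measure.map` is zero along maps that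
are not a.e. measurable. The target carries all the mass, so a.e. measurability holds. -/
theorem aemeasurable_extChartAt_symm (q : Γ) :
    AEMeasurable (extChartAt (𝓡 2) q).symm (volume.restrict (extChartAt (𝓡 2) q).target) :=
  (continuousOn_extChartAt_symm q).aemeasurable (isOpen_extChartAt_target q).measurableSet

theorem measurableSet_target_inter_preimage (q : Γ) {C : Set Γ} (hC : MeasurableSet C) :
    MeasurableSet ((extChartAt (𝓡 2) q).target ∩ (extChartAt (𝓡 2) q).symm ⁻¹' C) := by
  have h1 : Measurable ((extChartAt (𝓡 2) q).target.domRestrict (extChartAt (𝓡 2) q).symm) :=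
    (continuousOn_iff_continuous_domRestrict.1 (continuousOn_extChartAt_symm q)).measurable
  have h2 := MeasurableSet.subtype_image (isOpen_extChartAt_target (I := 𝓡 2) q).measurableSet
    (h1 hC)
  convert h2 using 1
  ext y
  simp [and_comm]

theorem chartArea_apply (q : Γ) {C : Set Γ} (hC : MeasurableSet C) :
    chartArea q C = ∫⁻ y in (extChartAt (𝓡 2) q).target ∩ (extChartAt (𝓡 2) q).symm ⁻¹' C,
      ENNReal.ofReal (areaDensity q y) := by
  rw [chartArea, Measure.map_apply_of_aemeasurable
    ((aemeasurable_extChartAt_symm q).mono_ac (withDensity_absolutelyContinuous _ _)) hC,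
    withDensity_apply', Measure.restrict_restrict' (isOpen_extChartAt_target q).measurableSet,
    inter_comm]

theorem chartArea_inter_source (q : Γ) {C : Set Γ} (hC : MeasurableSet C) :
    chartArea q (C ∩ (extChartAt (𝓡 2) q).source) = chartArea q C := by
  rw [chartArea_apply q hC,
    chartArea_apply q (hC.inter (isOpen_extChartAt_source (I := 𝓡 2) q).measurableSet)]
  congr 2
  ext y
  simp only [mem_inter_iff, mem_preimage]
  exact ⟨fun h => ⟨h.1, h.2.1⟩, fun h => ⟨h.1, h.2, (extChartAt (𝓡 2) q).map_target h.1⟩⟩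

/-- `(AB)*(AB) = B* (A* A) B` and `det B* = det B`. After a square root, this is the Jacobian factor
in a change of chart. -/
theorem det_adjoint_comp_self_comp (A : Plane →L[ℝ] Space) (B : Plane →L[ℝ] Plane) :
    ((A ∘L B).adjoint ∘L (A ∘L B)).det = B.det ^ 2 * (A.adjoint ∘L A).det := by
  have h : (((A ∘L B).adjoint ∘L (A ∘L B) : Plane →L[ℝ] Plane) : Plane →ₗ[ℝ] Plane)
      = LinearMap.adjoint (B : Plane →ₗ[ℝ] Plane) ∘ₗ
        (((A.adjoint ∘L A : Plane →L[ℝ] Plane) : Plane →ₗ[ℝ] Plane) ∘ₗ (B : Plane →ₗ[ℝ] Plane)) := by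
    rw [ContinuousLinearMap.adjoint_comp]
    rfl
  have hB : LinearMap.det (LinearMap.adjoint (B : Plane →ₗ[ℝ] Plane))
      = LinearMap.det (B : Plane →ₗ[ℝ] Plane) := by
    rw [← LinearMap.det_toMatrix (EuclideanSpace.basisFun (Fin 2) ℝ).toBasis,
      LinearMap.toMatrix_adjoint, Matrix.det_conjTranspose, LinearMap.det_toMatrix]
    simp
  rw [ContinuousLinearMap.det, h, LinearMap.det_comp, LinearMap.det_comp, hB,
    ContinuousLinearMap.det, ContinuousLinearMap.det]
  ring

variable [IsManifold (𝓡 2) ∞ Γ]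

theorem continuousOn_areaDensity (hΓ : IsClosedSurface Γ) (q : Γ) :
    ContinuousOn (areaDensity q) (extChartAt (𝓡 2) q).target := by
  have : areaDensity q = fun y => Real.sqrt (gramDet (param q) y) :=
    funext (areaDensity_eq_sqrt_gramDet q)
  rw [this]
  exact fun y hy => (contDiffAt_gramDet (contDiffAt_param hΓ hy)).continuousAt.sqrt.continuousWithinAt

/-- The area densities of two charts are related by the Jacobian of the change of coordinates. -/
theorem areaDensity_eq_abs_det_mul (hΓ : IsClosedSurface Γ) {q q' : Γ} {y : Plane}
    (hy : y ∈ (extChartAt (𝓡 2) q).target)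
    (hy' : (extChartAt (𝓡 2) q).symm y ∈ (extChartAt (𝓡 2) q').source) :
    ∃ B : Plane →L[ℝ] Plane,
      HasFDerivAt (fun z => extChartAt (𝓡 2) q' ((extChartAt (𝓡 2) q).symm z)) B y ∧
      areaDensity q y
        = |B.det| * areaDensity q' (extChartAt (𝓡 2) q' ((extChartAt (𝓡 2) q).symm y)) := by
  have hs : (extChartAt (𝓡 2) q).symm ⁻¹' (extChartAt (𝓡 2) q').source ∈ nhds y :=
    ((continuousOn_extChartAt_symm q).continuousAt (extChartAt_target_mem_nhds_of_mem hy))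
      ((isOpen_extChartAt_source q').mem_nhds hy')
  have hτ : DifferentiableAt ℝ
      (fun z => extChartAt (𝓡 2) q' ((extChartAt (𝓡 2) q).symm z)) y := by
    have h1 : ContMDiffAt (𝓡 2) 𝓘(ℝ, Plane) ∞ (extChartAt (𝓡 2) q')
        ((extChartAt (𝓡 2) q).symm y) :=
      contMDiffAt_extChartAt' (by rwa [extChartAt_source] at hy')
    have h2 : ContMDiffAt 𝓘(ℝ, Plane) (𝓡 2) ∞ (extChartAt (𝓡 2) q).symm y :=
      (contMDiffOn_extChartAt_symm q).contMDiffAt (extChartAt_target_mem_nhds_of_mem hy)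
    exact (h1.comp y h2).contDiffAt.differentiableAt (by simp)
  refine ⟨_, hτ.hasFDerivAt, ?_⟩
  have he : param q =ᶠ[nhds y]
      fun z => param q' (extChartAt (𝓡 2) q' ((extChartAt (𝓡 2) q).symm z)) := by
    filter_upwards [hs] with z hz
    exact congrArg Subtype.val ((extChartAt (𝓡 2) q').left_inv hz).symm
  have hφ : HasFDerivAt (param q') _ (extChartAt (𝓡 2) q' ((extChartAt (𝓡 2) q).symm y)) :=
    ((contDiffAt_param hΓ ((extChartAt (𝓡 2) q').map_source hy')).differentiableAt
      (by simp)).hasFDerivAt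
  have hc := he.fderiv_eq.trans (hφ.comp y hτ.hasFDerivAt).fderiv
  change Real.sqrt (((fderiv ℝ (param q) y).adjoint ∘L fderiv ℝ (param q) y).det) = _
  rw [hc, det_adjoint_comp_self_comp, Real.sqrt_mul (sq_nonneg _), Real.sqrt_sq_eq_abs]
  rfl

/-- Change of variables along the transition map `τ`, whose Jacobian is exactly the quotient of the
two densities. -/
theorem chartArea_eq_chartArea (hΓ : IsClosedSurface Γ) (q q' : Γ) {C : Set Γ}
    (hC : MeasurableSet C) (h : C ⊆ (extChartAt (𝓡 2) q).source)
    (h' : C ⊆ (extChartAt (𝓡 2) q').source) : chartArea q C = chartArea q' C := by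
  set τ : Plane → Plane := fun z => extChartAt (𝓡 2) q' ((extChartAt (𝓡 2) q).symm z) with hτ
  set D := (extChartAt (𝓡 2) q).target ∩ (extChartAt (𝓡 2) q).symm ⁻¹' C with hD
  have himage : (extChartAt (𝓡 2) q').target ∩ (extChartAt (𝓡 2) q').symm ⁻¹' C = τ '' D := by
    ext y
    constructor
    · rintro ⟨hy, hyC⟩
      refine ⟨extChartAt (𝓡 2) q ((extChartAt (𝓡 2) q').symm y),
        ⟨(extChartAt (𝓡 2) q).map_source (h hyC), ?_⟩, ?_⟩
      · rw [mem_preimage, (extChartAt (𝓡 2) q).left_inv (h hyC)]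
        exact hyC
      · simp only [hτ]
        rw [(extChartAt (𝓡 2) q).left_inv (h hyC), (extChartAt (𝓡 2) q').right_inv hy]
    · rintro ⟨z, ⟨hz, hzC⟩, rfl⟩
      refine ⟨(extChartAt (𝓡 2) q').map_source (h' hzC), ?_⟩
      rw [mem_preimage, (extChartAt (𝓡 2) q').left_inv (h' hzC)]
      exact hzC
  have hinj : InjOn τ D := by
    intro a ha b hb hab
    exact (extChartAt (𝓡 2) q).symm.injOn ha.1 hb.1
      ((extChartAt (𝓡 2) q').injOn (h' ha.2) (h' hb.2) hab)
  have key := fun y (hy : y ∈ D) => areaDensity_eq_abs_det_mul hΓ (q' := q') hy.1 (h' hy.2)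
  choose! B hB hdens using key
  rw [chartArea_apply q hC, chartArea_apply q' hC, himage,
    lintegral_image_eq_lintegral_abs_det_fderiv_mul volume
      (measurableSet_target_inter_preimage q hC) (fun y hy => (hB y hy).hasFDerivWithinAt) hinj]
  refine setLIntegral_congr_fun (measurableSet_target_inter_preimage q hC) fun y hy => ?_
  rw [hdens y hy, ENNReal.ofReal_mul (abs_nonneg _)]

/-- The area measure restricts to the local area measure on every chart domain. -/
theorem areaMeasure_restrict_source (hΓ : IsClosedSurface Γ) (q : Γ) :
    (areaMeasure Γ).restrict (extChartAt (𝓡 2) q).source = chartArea q := by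
  have hS : MeasurableSet (extChartAt (𝓡 2) q).source :=
    (isOpen_extChartAt_source (I := 𝓡 2) q).measurableSet
  have hle : chartArea q ≤ areaMeasure Γ := le_iSup chartArea q
  -- A supremum of measures is not computed set by set, so it is bounded through one measure
  -- dominating every `chartArea q'`: the local area inside the chart domain, `areaMeasure` itself
  -- outside.
  have hge : areaMeasure Γ
      ≤ chartArea q + (areaMeasure Γ).restrict (extChartAt (𝓡 2) q).sourceᶜ := by
    refine iSup_le fun q' => Measure.le_iff.2 fun C hC => ?_
    have h1 : chartArea q' (C ∩ (extChartAt (𝓡 2) q).source) ≤ chartArea q C := by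
      rw [← chartArea_inter_source q' (hC.inter hS),
        chartArea_eq_chartArea hΓ q' q
          ((hC.inter hS).inter (isOpen_extChartAt_source (I := 𝓡 2) q').measurableSet)
          (fun _ hp => hp.2) (fun _ hp => hp.1.2)]
      exact measure_mono fun _ hp => hp.1.1
    have h2 : chartArea q' (C \ (extChartAt (𝓡 2) q).source)
        ≤ (areaMeasure Γ).restrict (extChartAt (𝓡 2) q).sourceᶜ C := by
      rw [Measure.restrict_apply hC]
      exact (le_iSup chartArea q' : chartArea q' ≤ areaMeasure Γ) _
    rw [← measure_inter_add_sdiff C hS]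
    exact add_le_add h1 h2
  refine le_antisymm (Measure.le_iff.2 fun C hC => ?_) (Measure.le_iff.2 fun C hC => ?_)
  · rw [Measure.restrict_apply hC]
    refine (hge _).trans ?_
    rw [Measure.add_apply, Measure.restrict_apply (hC.inter hS), inter_assoc, inter_compl_self,
      inter_empty, measure_empty, add_zero]
    exact measure_mono inter_subset_left
  · rw [Measure.restrict_apply hC, ← chartArea_inter_source q hC]
    exact hle _

theorem areaMeasure_eq_chartArea (hΓ : IsClosedSurface Γ) (q : Γ) {C : Set Γ}
    (hC : MeasurableSet C) (h : C ⊆ (extChartAt (𝓡 2) q).source) :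
    areaMeasure Γ C = chartArea q C := by
  rw [← areaMeasure_restrict_source hΓ q, Measure.restrict_apply hC, inter_eq_self_of_subset_left h]

/-- A density may be unbounded on a whole chart target, but it is bounded on a small ball by
continuity. Local finiteness and compactness then give finiteness. -/
theorem isFiniteMeasure_areaMeasure (hΓ : IsClosedSurface Γ) : IsFiniteMeasure (areaMeasure Γ) := by
  have : CompactSpace Γ := isCompact_iff_compactSpace.1 hΓ.isCompact
  have : IsLocallyFiniteMeasure (areaMeasure Γ) := by
    refine ⟨fun p => ?_⟩
    obtain ⟨c, hc⟩ : ∃ c, c = extChartAt (𝓡 2) p p := ⟨_, rfl⟩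
    have hy : c ∈ (extChartAt (𝓡 2) p).target := hc ▸ mem_extChartAt_target (I := 𝓡 2) p
    have hcont : ContinuousAt (areaDensity p) c :=
      (continuousOn_areaDensity hΓ p).continuousAt (extChartAt_target_mem_nhds_of_mem hy)
    have hev : ∀ᶠ y in nhds c, areaDensity p y < areaDensity p c + 1 :=
      hcont.eventually_lt_const (lt_add_one _)
    obtain ⟨r, hr, hball⟩ := Metric.eventually_nhds_iff_ball.1 hev
    have hopen : IsOpen ((extChartAt (𝓡 2) p).source ∩ extChartAt (𝓡 2) p ⁻¹' Metric.ball c r) :=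
      isOpen_extChartAt_preimage' p Metric.isOpen_ball
    refine ⟨_, hopen.mem_nhds ⟨mem_extChartAt_source p, by
      rw [mem_preimage, ← hc]; exact Metric.mem_ball_self hr⟩, ?_⟩
    rw [areaMeasure_eq_chartArea hΓ p hopen.measurableSet inter_subset_left,
      chartArea_apply p hopen.measurableSet]
    have hsub : (extChartAt (𝓡 2) p).target ∩ (extChartAt (𝓡 2) p).symm ⁻¹'
        ((extChartAt (𝓡 2) p).source ∩
          extChartAt (𝓡 2) p ⁻¹' Metric.ball c r)
        ⊆ Metric.ball c r := by
      rintro y ⟨hy, -, hyb⟩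
      rwa [mem_preimage, (extChartAt (𝓡 2) p).right_inv hy] at hyb
    calc _ ≤ ∫⁻ y in Metric.ball c r, ENNReal.ofReal (areaDensity p y) :=
          lintegral_mono_set hsub
      _ ≤ ∫⁻ y in Metric.ball c r,
            ENNReal.ofReal (areaDensity p c + 1) :=
          setLIntegral_mono measurable_const fun y hy => ENNReal.ofReal_le_ofReal (hball y hy).le
      _ < ⊤ := by
          rw [setLIntegral_const]
          exact ENNReal.mul_lt_top ENNReal.ofReal_lt_top measure_ball_lt_top
  infer_instance

theorem Continuous.integrable_areaMeasure (hΓ : IsClosedSurface Γ) {F : Type*}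
    [NormedAddCommGroup F] {h : Γ → F} (hh : Continuous h) : Integrable h (areaMeasure Γ) := by
  have : CompactSpace Γ := isCompact_iff_compactSpace.1 hΓ.isCompact
  have := isFiniteMeasure_areaMeasure hΓ
  exact hh.integrable_of_hasCompactSupport (HasCompactSupport.of_compactSpace h)

/-- The integral of a function supported in a chart domain, in the coordinates of the chart. -/
theorem integral_areaMeasure_of_support_subset (hΓ : IsClosedSurface Γ) (q : Γ) {h : Γ → ℝ}
    (hh : AEStronglyMeasurable h (areaMeasure Γ))
    (hs : Function.support h ⊆ (extChartAt (𝓡 2) q).source) :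
    ∫ p, h p ∂(areaMeasure Γ) = ∫ y in (extChartAt (𝓡 2) q).target,
      areaDensity q y * h ((extChartAt (𝓡 2) q).symm y) := by
  have hT : MeasurableSet (extChartAt (𝓡 2) q).target :=
    (isOpen_extChartAt_target (I := 𝓡 2) q).measurableSet
  rw [← setIntegral_eq_integral_of_forall_compl_eq_zero
    (fun p hp => by_contra fun hne => hp (hs hne)), areaMeasure_restrict_source hΓ q]
  have hh' : AEStronglyMeasurable h (chartArea q) := by
    rw [← areaMeasure_restrict_source hΓ q]
    exact hh.restrict
  rw [chartArea] at hh' ⊢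
  rw [integral_map
    ((aemeasurable_extChartAt_symm q).mono_ac (withDensity_absolutelyContinuous _ _)) hh',
    integral_withDensity_eq_integral_toReal_smul₀
      (((continuousOn_areaDensity hΓ q).aemeasurable hT).ennreal_ofReal) (by simp)]
  refine setIntegral_congr_fun hT fun y _ => ?_
  simp only [smul_eq_mul]
  rw [ENNReal.toReal_ofReal (show 0 ≤ areaDensity q y from Real.sqrt_nonneg _)]

end Area

/-! ### Integration by parts in a chart and Green's identity. -/

/-- As `g` vanishes on `U \ K`, its extension by zero is `C¹` on the plane with compact support, and
the whole-plane statement applies. -/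
theorem setIntegral_partialDeriv_eq_zero {U K : Set Plane} (hU : IsOpen U) (hK : IsCompact K)
    (hKU : K ⊆ U) {g : Plane → ℝ} (hg : ∀ y ∈ U, ContDiffAt ℝ 1 g y) (h0 : ∀ y ∈ U \ K, g y = 0)
    (i : Fin 2) :
    IntegrableOn (partialDeriv i g) U ∧ ∫ y in U, partialDeriv i g y = 0 := by
  classical
  have hin {y : Plane} (hy : y ∈ U) : U.indicator g =ᶠ[nhds y] g := by
    filter_upwards [hU.mem_nhds hy] with z hz using indicator_of_mem hz g
  have hout {y : Plane} (hy : y ∉ K) : U.indicator g =ᶠ[nhds y] fun _ => 0 := by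
    filter_upwards [hK.isClosed.isOpen_compl.mem_nhds hy] with z hz
    by_cases hzU : z ∈ U
    · rw [indicator_of_mem hzU, h0 z ⟨hzU, hz⟩]
    · rw [indicator_of_notMem hzU]
  have hψ : ContDiff ℝ 1 (U.indicator g) := by
    rw [contDiff_iff_contDiffAt]
    intro y
    by_cases hy : y ∈ U
    · exact (hg y hy).congr_of_eventuallyEq (hin hy)
    · exact contDiffAt_const.congr_of_eventuallyEq (hout fun hyK => hy (hKU hyK))
  have hψc : HasCompactSupport (U.indicator g) :=
    HasCompactSupport.intro hK fun y hy => (hout hy).self_of_nhds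
  have hcongr : EqOn (partialDeriv i (U.indicator g)) (partialDeriv i g) U :=
    fun y hy => partialDeriv_congr (hin hy) i
  have hzero : ∀ y ∉ U, partialDeriv i (U.indicator g) y = 0 := by
    intro y hy
    rw [partialDeriv_congr (hout fun hyK => hy (hKU hyK))]
    simp [partialDeriv]
  have hint : Integrable (partialDeriv i (U.indicator g)) :=
    ((hψ.continuous_fderiv (by simp)).clm_apply continuous_const).integrable_of_hasCompactSupport
      ((hψc.fderiv ℝ).comp_left
        (g := fun L : Plane →L[ℝ] ℝ => L (EuclideanSpace.single i (1 : ℝ))) (by simp))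
  refine ⟨hint.integrableOn.congr_fun hcongr hU.measurableSet, ?_⟩
  rw [← setIntegral_congr_fun hU.measurableSet hcongr,
    setIntegral_eq_integral_of_forall_compl_eq_zero hzero]
  exact integral_partialDeriv_eq_zero i hψ hψc

section Green

variable {Γ : Set Space} [ChartedSpace Plane Γ]

theorem surfaceGradient_eq_zero_of_eventuallyEq {w : Γ → ℝ} {p : Γ}
    (h : w =ᶠ[nhds p] fun _ => 0) : surfaceGradient w p = 0 := by
  have : scalarDeriv w p = 0 := h.mfderiv_eq.trans mfderiv_const
  rw [surfaceGradient, this]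
  simp

theorem surfaceGradient_add {v w : Γ → ℝ} {p : Γ}
    (hv : MDifferentiableAt (𝓡 2) 𝓘(ℝ, ℝ) v p) (hw : MDifferentiableAt (𝓡 2) 𝓘(ℝ, ℝ) w p) :
    surfaceGradient (fun r => v r + w r) p = surfaceGradient v p + surfaceGradient w p := by
  have : scalarDeriv (fun r => v r + w r) p = scalarDeriv v p + scalarDeriv w p :=
    (hv.hasMFDerivAt.add hw.hasMFDerivAt).mfderiv
  simp only [surfaceGradient, this, map_add]

theorem surfaceGradient_sub {v w : Γ → ℝ} {p : Γ}
    (hv : MDifferentiableAt (𝓡 2) 𝓘(ℝ, ℝ) v p) (hw : MDifferentiableAt (𝓡 2) 𝓘(ℝ, ℝ) w p) :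
    surfaceGradient (fun r => v r - w r) p = surfaceGradient v p - surfaceGradient w p := by
  have : scalarDeriv (fun r => v r - w r) p = scalarDeriv v p - scalarDeriv w p :=
    (hv.hasMFDerivAt.sub hw.hasMFDerivAt).mfderiv
  simp only [surfaceGradient, this, map_sub]

variable [IsManifold (𝓡 2) ∞ Γ]

theorem continuous_laplaceBeltrami (hΓ : IsClosedSurface Γ) {v : Γ → ℝ}
    (hv : ContMDiff (𝓡 2) 𝓘(ℝ, ℝ) ∞ v) : Continuous (laplaceBeltrami v) := by
  rw [continuous_iff_continuousAt]
  intro p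
  obtain ⟨c, hc⟩ : ∃ c, c = extChartAt (𝓡 2) p p := ⟨_, rfl⟩
  have hy : c ∈ (extChartAt (𝓡 2) p).target := hc ▸ mem_extChartAt_target (I := 𝓡 2) p
  set f : Plane → ℝ := fun z => v ((extChartAt (𝓡 2) p).symm z) with hf
  set Λ : Plane → ℝ := fun y => ∑ k : Fin 3,
    localGradient (param p) (fun z => localGradient (param p) f z k) y k with hΛ
  have h1 : ContinuousAt Λ c := by
    refine tendsto_finsetSum _ fun k _ => ?_
    have hk {g : Plane → Space} (hg : ContDiffAt ℝ ∞ g c) : ContDiffAt ℝ ∞ (fun z => g z k) c :=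
      (EuclideanSpace.proj (𝕜 := ℝ) k : Space →L[ℝ] ℝ).contDiff.contDiffAt.comp c hg
    exact (hk (contDiffAt_localGradient (contDiffAt_param hΓ hy)
      (hk (contDiffAt_localGradient (contDiffAt_param hΓ hy)
        (hv.contDiffAt_comp_extChartAt_symm hy) (gramDet_param_pos hΓ hy).ne'))
      (gramDet_param_pos hΓ hy).ne')).continuousAt
  rw [hc] at h1
  have h2 : ContinuousAt (fun r : Γ => Λ (extChartAt (𝓡 2) p r)) p :=
    ContinuousAt.comp (g := Λ) h1 (continuousAt_extChartAt p)
  refine h2.congr ?_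
  filter_upwards [extChartAt_source_mem_nhds (I := 𝓡 2) p] with r hr
  have := laplaceBeltrami_extChartAt_symm hΓ ((extChartAt (𝓡 2) p).map_source hr) hv
  rw [(extChartAt (𝓡 2) p).left_inv hr] at this
  exact this.symm

theorem continuous_green_integrand (hΓ : IsClosedSurface Γ) {v w : Γ → ℝ}
    (hv : ContMDiff (𝓡 2) 𝓘(ℝ, ℝ) ∞ v) (hw : ContMDiff (𝓡 2) 𝓘(ℝ, ℝ) ∞ w) :
    Continuous fun p => w p * laplaceBeltrami v p
      + inner ℝ (surfaceGradient v p) (surfaceGradient w p) :=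
  (hw.continuous.mul (continuous_laplaceBeltrami hΓ hv)).add
    ((continuous_surfaceGradient hΓ hv).inner (continuous_surfaceGradient hΓ hw))

/-- Green's identity, for a test function supported in a chart domain. -/
theorem integral_green_of_tsupport_subset (hΓ : IsClosedSurface Γ) {v w : Γ → ℝ}
    (hv : ContMDiff (𝓡 2) 𝓘(ℝ, ℝ) ∞ v) (hw : ContMDiff (𝓡 2) 𝓘(ℝ, ℝ) ∞ w) (q : Γ)
    (hs : tsupport w ⊆ (extChartAt (𝓡 2) q).source) :
    ∫ p, (w p * laplaceBeltrami v p
      + inner ℝ (surfaceGradient v p) (surfaceGradient w p)) ∂(areaMeasure Γ) = 0 := by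
  have : CompactSpace Γ := isCompact_iff_compactSpace.1 hΓ.isCompact
  have hsupp : Function.support (fun p => w p * laplaceBeltrami v p
      + inner ℝ (surfaceGradient v p) (surfaceGradient w p)) ⊆ (extChartAt (𝓡 2) q).source := by
    refine subset_trans (fun p hp => ?_) hs
    by_contra hpt
    apply hp
    have h0 := notMem_tsupport_iff_eventuallyEq.1 hpt
    simp only
    rw [surfaceGradient_eq_zero_of_eventuallyEq h0, h0.self_of_nhds]
    simp
  rw [integral_areaMeasure_of_support_subset hΓ q
    (continuous_green_integrand hΓ hv hw).aestronglyMeasurable hsupp]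
  set φ := param q with hφ
  set f : Plane → ℝ := fun z => v ((extChartAt (𝓡 2) q).symm z) with hf
  set g : Plane → ℝ := fun z => w ((extChartAt (𝓡 2) q).symm z) with hg
  let c : Fin 2 → Plane → ℝ := fun i y => Real.sqrt (gramDet φ y) * gradCoord φ f i y
  have hU := isOpen_extChartAt_target (I := 𝓡 2) q
  have hfd {y} (hy : y ∈ (extChartAt (𝓡 2) q).target) : ContDiffAt ℝ ∞ f y :=
    hv.contDiffAt_comp_extChartAt_symm hy
  have hgd {y} (hy : y ∈ (extChartAt (𝓡 2) q).target) : ContDiffAt ℝ ∞ g y :=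
    hw.contDiffAt_comp_extChartAt_symm hy
  have hcd (i : Fin 2) {y} (hy : y ∈ (extChartAt (𝓡 2) q).target) : ContDiffAt ℝ ∞ (c i) y :=
    ((contDiffAt_gramDet (contDiffAt_param hΓ hy)).sqrt (gramDet_param_pos hΓ hy).ne').mul
      (contDiffAt_gradCoord (contDiffAt_param hΓ hy) (hfd hy) (gramDet_param_pos hΓ hy).ne' i)
  have hK : IsCompact (extChartAt (𝓡 2) q '' tsupport w) :=
    (isClosed_tsupport w).isCompact.image_of_continuousOn ((continuousOn_extChartAt q).mono hs)
  have hKU : extChartAt (𝓡 2) q '' tsupport w ⊆ (extChartAt (𝓡 2) q).target := by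
    rintro _ ⟨p, hp, rfl⟩
    exact (extChartAt (𝓡 2) q).map_source (hs hp)
  have h0 : ∀ y ∈ (extChartAt (𝓡 2) q).target \ (extChartAt (𝓡 2) q '' tsupport w), g y = 0 := by
    rintro y ⟨hy, hyK⟩
    by_contra hne
    exact hyK ⟨_, subset_tsupport w hne, (extChartAt (𝓡 2) q).right_inv hy⟩
  have hI (i : Fin 2) := setIntegral_partialDeriv_eq_zero hU hK hKU (g := fun y => c i y * g y)
    (fun y hy => ((hcd i hy).mul (hgd hy)).of_le (by simp))
    (fun y hy => by rw [h0 y hy, mul_zero]) i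
  -- In coordinates the weighted integrand is the divergence of the field `g c`: the derivatives of
  -- `c` give the Laplacian term, those of `g` the inner product.
  have hcongr : EqOn (fun y => areaDensity q y * (w ((extChartAt (𝓡 2) q).symm y)
        * laplaceBeltrami v ((extChartAt (𝓡 2) q).symm y)
      + inner ℝ (surfaceGradient v ((extChartAt (𝓡 2) q).symm y))
        (surfaceGradient w ((extChartAt (𝓡 2) q).symm y))))
      (fun y => partialDeriv 0 (fun y => c 0 y * g y) y + partialDeriv 1 (fun y => c 1 y * g y) y)
      (extChartAt (𝓡 2) q).target := by
    intro y hy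
    have hdiv := sqrt_gramDet_mul_sum_localGradient (contDiffAt_param hΓ hy) (hfd hy)
      (gramDet_param_pos hΓ hy)
    simp only
    rw [partialDeriv_mul 0 ((hcd 0 hy).differentiableAt (by simp))
        ((hgd hy).differentiableAt (by simp)),
      partialDeriv_mul 1 ((hcd 1 hy).differentiableAt (by simp))
        ((hgd hy).differentiableAt (by simp)),
      laplaceBeltrami_extChartAt_symm hΓ hy hv,
      surfaceGradient_extChartAt_symm_of_contMDiff hΓ hy hv,
      surfaceGradient_extChartAt_symm_of_contMDiff hΓ hy hw,
      inner_localGradient_localGradient (gramDet_param_pos hΓ hy).ne', areaDensity_eq_sqrt_gramDet]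
    simp only [c] at hdiv ⊢
    linear_combination g y * hdiv
  rw [setIntegral_congr_fun hU.measurableSet hcongr, integral_add (hI 0).1 (hI 1).1, (hI 0).2,
    (hI 1).2, add_zero]

/-- Green's identity on a closed surface. -/
theorem integral_green (hΓ : IsClosedSurface Γ) {v w : Γ → ℝ}
    (hv : ContMDiff (𝓡 2) 𝓘(ℝ, ℝ) ∞ v) (hw : ContMDiff (𝓡 2) 𝓘(ℝ, ℝ) ∞ w) :
    ∫ p, (w p * laplaceBeltrami v p
      + inner ℝ (surfaceGradient v p) (surfaceGradient w p)) ∂(areaMeasure Γ) = 0 := by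
  classical
  have : CompactSpace Γ := isCompact_iff_compactSpace.1 hΓ.isCompact
  obtain ⟨ρ, hρ⟩ := SmoothPartitionOfUnity.exists_isSubordinate_chartAt_source (𝓡 2) Γ
  have hfin := ρ.locallyFinite.finite_nonempty_of_compact
  have hρs (i : Γ) : ContMDiff (𝓡 2) 𝓘(ℝ, ℝ) ∞ fun p => ρ i p * w p := (ρ i).contMDiff.mul hw
  -- Green's identity is additive in the test function. By compactness only finitely many members of
  -- the partition are nonzero, so induction over finite sets reaches `w`.
  have key (s : Finset Γ) : ContMDiff (𝓡 2) 𝓘(ℝ, ℝ) ∞ (fun p => ∑ i ∈ s, ρ i p * w p) ∧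
      ∫ p, ((∑ i ∈ s, ρ i p * w p) * laplaceBeltrami v p
        + inner ℝ (surfaceGradient v p)
          (surfaceGradient (fun r => ∑ i ∈ s, ρ i r * w r) p)) ∂(areaMeasure Γ) = 0 := by
    induction s using Finset.induction_on with
    | empty =>
      refine ⟨by simpa using contMDiff_const, ?_⟩
      have (p : Γ) : surfaceGradient (fun _ : Γ => (0 : ℝ)) p = 0 :=
        surfaceGradient_eq_zero_of_eventuallyEq (Filter.EventuallyEq.refl _ _)
      simp [this]
    | insert a s ha ih =>
      obtain ⟨h1, h2⟩ := ih
      simp only [Finset.sum_insert ha]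
      refine ⟨(hρs a).add h1, ?_⟩
      have ha0 := integral_green_of_tsupport_subset hΓ hv (hρs a) a (by
        rw [extChartAt_source]
        exact (tsupport_mul_subset_left (f := ρ a) (g := w)).trans (hρ a))
      rw [← add_zero (0 : ℝ)]
      nth_rw 1 [← ha0]
      rw [← h2, ← integral_add
        ((continuous_green_integrand hΓ hv (hρs a)).integrable_areaMeasure hΓ)
        ((continuous_green_integrand hΓ hv h1).integrable_areaMeasure hΓ)]
      refine integral_congr_ae (.of_forall fun p => ?_)
      simp only
      rw [surfaceGradient_add ((hρs a).mdifferentiable (by simp) p)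
        (h1.mdifferentiable (by simp) p), inner_add_right]
      ring
  have hsum : (fun p => ∑ i ∈ hfin.toFinset, ρ i p * w p) = w := by
    funext p
    rw [← Finset.sum_mul, ← finsum_eq_sum_of_support_subset (fun i => ρ i p), ρ.sum_eq_one
      (mem_univ p), one_mul]
    intro i hi
    simp only [Finite.coe_toFinset, mem_ofPred_eq]
    exact ⟨p, hi⟩
  have := (key hfin.toFinset).2
  rw [hsum] at this
  simpa only [congrFun hsum] using this

/-- The difference of the Dirichlet energies of two functions. -/
theorem integral_norm_sq_surfaceGradient_sub (hΓ : IsClosedSurface Γ) {v w : Γ → ℝ}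
    (hv : ContMDiff (𝓡 2) 𝓘(ℝ, ℝ) ∞ v) (hw : ContMDiff (𝓡 2) 𝓘(ℝ, ℝ) ∞ w) :
    ∫ p, ‖surfaceGradient v p‖ ^ 2 ∂(areaMeasure Γ)
        - ∫ p, ‖surfaceGradient w p‖ ^ 2 ∂(areaMeasure Γ)
      = -∫ p, (v p - w p) * (laplaceBeltrami v p + laplaceBeltrami w p) ∂(areaMeasure Γ) := by
  have hd : ContMDiff (𝓡 2) 𝓘(ℝ, ℝ) ∞ fun p => v p - w p := hv.sub hw
  -- Testing both `v` and `w` against `v - w` and adding gives `⟪∇v + ∇w, ∇v - ∇w⟫`, in which the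
  -- cross terms cancel.
  have h1 := integral_green hΓ hv hd
  have h2 := integral_green hΓ hw hd
  have hV : Continuous fun p => ‖surfaceGradient v p‖ ^ 2 :=
    (continuous_surfaceGradient hΓ hv).norm.pow 2
  have hW : Continuous fun p => ‖surfaceGradient w p‖ ^ 2 :=
    (continuous_surfaceGradient hΓ hw).norm.pow 2
  have hL : Continuous fun p => (v p - w p) * (laplaceBeltrami v p + laplaceBeltrami w p) := hd.continuous.mul
    ((continuous_laplaceBeltrami hΓ hv).add (continuous_laplaceBeltrami hΓ hw))
  have h3 := integral_add ((continuous_green_integrand hΓ hv hd).integrable_areaMeasure hΓ)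
    ((continuous_green_integrand hΓ hw hd).integrable_areaMeasure hΓ)
  rw [h1, h2, add_zero] at h3
  rw [eq_neg_iff_add_eq_zero, ← integral_sub (hV.integrable_areaMeasure hΓ)
    (hW.integrable_areaMeasure hΓ), ← integral_add ((hV.fun_sub hW).integrable_areaMeasure hΓ)
    (hL.integrable_areaMeasure hΓ), ← h3]
  refine integral_congr_ae (.of_forall fun p => ?_)
  simp only
  rw [surfaceGradient_sub (hv.mdifferentiable (by simp) p) (hw.mdifferentiable (by simp) p),
    inner_sub_right, inner_sub_right, real_inner_self_eq_norm_sq, real_inner_self_eq_norm_sq,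
    real_inner_comm (surfaceGradient v p) (surfaceGradient w p)]
  ring

end Green

/-! ### Energy differences and the dissipation law. -/

theorem continuous_potential_div {X : Type*} [TopologicalSpace X] (ε b : ℝ) {v : X → ℝ}
    (hv : Continuous v) : Continuous fun p => potential b (v p) / ε ^ 2 := by
  unfold potential; fun_prop

section Evolution

variable {Γ : Set Space} [ChartedSpace Plane Γ] {ε b T : ℝ} {u : ℝ → Γ → ℝ}

theorem IsSmoothSolution.contMDiff (hu : IsSmoothSolution ε b T u) {t : ℝ} (ht : t ∈ Icc 0 T) :
    ContMDiff (𝓡 2) 𝓘(ℝ, ℝ) ∞ (u t) := by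
  rw [← contMDiffOn_univ]
  exact hu.smooth.comp (t := Icc 0 T ×ˢ univ) (f := fun p : Γ => (t, p))
    (contMDiff_const.prodMk contMDiff_id).contMDiffOn fun p _ => ⟨ht, mem_univ p⟩

theorem IsSmoothSolution.contDiffOn_time (hu : IsSmoothSolution ε b T u) (p : Γ) :
    ContDiffOn ℝ ∞ (fun s => u s p) (Icc 0 T) :=
  (hu.smooth.comp (t := Icc 0 T ×ˢ univ) (f := fun s : ℝ => (s, p))
    (contMDiff_id.prodMk contMDiff_const).contMDiffOn fun _ hs => ⟨hs, mem_univ p⟩).contDiffOn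

theorem IsSmoothSolution.hasDerivWithinAt (hu : IsSmoothSolution ε b T u) (p : Γ) {t : ℝ}
    (ht : t ∈ Icc 0 T) : HasDerivWithinAt (fun s => u s p) (timeDeriv T u t p) (Icc 0 T) t :=
  ((hu.contDiffOn_time p).differentiableOn (by simp) t ht).hasDerivWithinAt

/-- The mean slope of the potential between two values. -/
noncomputable def potentialSlope (b r s : ℝ) : ℝ :=
  1 / 4 * (r ^ 3 + r ^ 2 * s + r * s ^ 2 + s ^ 3) - 1 / 2 * (r + s) + b

theorem potential_sub_potential (b r s : ℝ) :
    potential b r - potential b s = (r - s) * potentialSlope b r s := by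
  simp only [potential, potentialSlope]; ring

/-- The factor of `v - w` in the integrand of the difference of the energies of `v` and `w`. -/
noncomputable def energySlope (ε b : ℝ) (v w : Γ → ℝ) (p : Γ) : ℝ :=
  -(1 / 2) * (laplaceBeltrami v p + laplaceBeltrami w p) + potentialSlope b (v p) (w p) / ε ^ 2

/-- Solved for the Laplacian, the equation yields joint continuity of `Δ_Γ u` in time and space from
that of `u_t` and `u`. -/
theorem IsSmoothSolution.laplaceBeltrami_eq (hu : IsSmoothSolution ε b T u) {t : ℝ}
    (ht : t ∈ Icc 0 T) (p : Γ) :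
    laplaceBeltrami (u t) p = timeDeriv T u t p + 1 / ε ^ 2 * reaction b (u t p) := by
  rw [hu.equation t ht p]; ring

/-- On the diagonal `potentialSlope` is `F_m' = f_m`, so the slope is the first variation of the
energy. -/
theorem IsSmoothSolution.energySlope_self (hu : IsSmoothSolution ε b T u) {t : ℝ}
    (ht : t ∈ Icc 0 T) (p : Γ) : energySlope ε b (u t) (u t) p = -timeDeriv T u t p := by
  rw [energySlope, hu.laplaceBeltrami_eq ht, potentialSlope, reaction]
  ring

variable [IsManifold (𝓡 2) ∞ Γ]

/-- The time derivative of a smooth solution is jointly continuous. -/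
theorem IsSmoothSolution.continuousOn_timeDeriv (hu : IsSmoothSolution ε b T u) (hT : 0 < T) :
    ContinuousOn (fun z : ℝ × Γ => timeDeriv T u z.1 z.2) (Icc 0 T ×ˢ univ) := by
  rintro ⟨t, p⟩ ⟨ht, -⟩
  set S : Set (ℝ × Plane) := Icc 0 T ×ˢ (extChartAt (𝓡 2) p).target with hS
  set U : ℝ × Plane → ℝ := fun z => u z.1 ((extChartAt (𝓡 2) p).symm z.2) with hU
  have hUS : ContDiffOn ℝ ∞ U S := by
    have h2 : ContMDiffOn (𝓘(ℝ, ℝ).prod 𝓘(ℝ, Plane)) (𝓘(ℝ, ℝ).prod (𝓡 2)) ∞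
        (fun z : ℝ × Plane => (z.1, (extChartAt (𝓡 2) p).symm z.2)) S :=
      contMDiff_fst.contMDiffOn.prodMk ((contMDiffOn_extChartAt_symm p).comp
        contMDiff_snd.contMDiffOn fun z hz => hz.2)
    have h3 := hu.smooth.comp h2 fun z hz => ⟨hz.1, mem_univ _⟩
    rw [← modelWithCornersSelf_prod, chartedSpaceSelf_prod] at h3
    exact h3.contDiffOn
  have hSu : UniqueDiffOn ℝ S :=
    (uniqueDiffOn_Icc hT).prod (isOpen_extChartAt_target (I := 𝓡 2) p).uniqueDiffOn
  have hD : ContinuousOn (fun z => fderivWithin ℝ U S z (1, 0)) S :=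
    (hUS.continuousOn_fderivWithin hSu (by simp)).clm_apply continuousOn_const
  -- The one-sided time derivative is the directional derivative along `(1, 0)` within `S`. Unique
  -- differentiability, which needs `0 < T`, makes both well determined up to the end points.
  have heq : ∀ z ∈ S, timeDeriv T u z.1 ((extChartAt (𝓡 2) p).symm z.2)
      = fderivWithin ℝ U S z (1, 0) := by
    rintro ⟨s, y⟩ hz
    have h1 : HasFDerivWithinAt U _ S (s, y) :=
      (hUS.differentiableOn (by simp) _ hz).hasFDerivWithinAt
    have h2 : HasDerivWithinAt (fun r : ℝ => (r, y)) (1, 0) (Icc 0 T) s :=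
      (hasDerivWithinAt_id s _).prodMk (hasDerivWithinAt_const s _ y)
    have hm : MapsTo (fun r : ℝ => (r, y)) (Icc 0 T) S := fun r hr => ⟨hr, hz.2⟩
    exact (h1.comp_hasDerivWithinAt s h2 hm).derivWithin
      (uniqueDiffOn_Icc hT s hz.1)
  have hmaps : MapsTo (fun z : ℝ × Γ => (z.1, extChartAt (𝓡 2) p z.2))
      (Icc 0 T ×ˢ (extChartAt (𝓡 2) p).source) S :=
    fun z hz => ⟨hz.1, (extChartAt (𝓡 2) p).map_source hz.2⟩
  have hc : ContinuousOn (fun z : ℝ × Γ => (z.1, extChartAt (𝓡 2) p z.2))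
      (Icc 0 T ×ˢ (extChartAt (𝓡 2) p).source) :=
    continuousOn_fst.prodMk ((continuousOn_extChartAt p).comp continuousOn_snd fun z hz => hz.2)
  have hloc : ContinuousOn (fun z : ℝ × Γ => timeDeriv T u z.1 z.2)
      (Icc 0 T ×ˢ (extChartAt (𝓡 2) p).source) := by
    refine (hD.comp hc hmaps).congr fun z hz => ?_
    have := heq _ (hmaps hz)
    simp only [(extChartAt (𝓡 2) p).left_inv hz.2] at this
    exact this
  refine (hloc (t, p) ⟨ht, mem_extChartAt_source p⟩).mono_of_mem_nhdsWithin ?_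
  have hnhds : (univ : Set ℝ) ×ˢ (extChartAt (𝓡 2) p).source ∈ nhds (t, p) :=
    prod_mem_nhds Filter.univ_mem (extChartAt_source_mem_nhds p)
  exact Filter.mem_of_superset (inter_mem_nhdsWithin _ hnhds) fun z hz => ⟨hz.1.1, hz.2.2⟩

/-- The Dirichlet part factors through `v - w` by Green's identity and the potential part by
polynomial division, so the identity is exact, with no remainder to estimate. -/
theorem energy_sub_energy (hΓ : IsClosedSurface Γ) {v w : Γ → ℝ}
    (hv : ContMDiff (𝓡 2) 𝓘(ℝ, ℝ) ∞ v) (hw : ContMDiff (𝓡 2) 𝓘(ℝ, ℝ) ∞ w) :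
    energy ε b v - energy ε b w
      = ∫ p, (v p - w p) * energySlope ε b v w p ∂(areaMeasure Γ) := by
  have hL : Continuous fun p => (v p - w p) * (laplaceBeltrami v p + laplaceBeltrami w p) :=
    (hv.sub hw).continuous.mul
      ((continuous_laplaceBeltrami hΓ hv).add (continuous_laplaceBeltrami hΓ hw))
  have hPv := continuous_potential_div ε b hv.continuous
  have hPw := continuous_potential_div ε b hw.continuous
  have h1 := integral_norm_sq_surfaceGradient_sub hΓ hv hw
  have h2 := integral_sub (hPv.integrable_areaMeasure hΓ) (hPw.integrable_areaMeasure hΓ)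
  have h3 := integral_add ((hL.integrable_areaMeasure hΓ).const_mul (-(1 / 2)))
    ((hPv.fun_sub hPw).integrable_areaMeasure hΓ)
  rw [integral_const_mul] at h3
  have h4 : ∫ p, (v p - w p) * energySlope ε b v w p ∂(areaMeasure Γ)
      = -(1 / 2) * ∫ p, (v p - w p) * (laplaceBeltrami v p + laplaceBeltrami w p) ∂(areaMeasure Γ)
        + ∫ p, (potential b (v p) / ε ^ 2 - potential b (w p) / ε ^ 2) ∂(areaMeasure Γ) := by
    rw [← h3]
    refine integral_congr_ae (.of_forall fun p => ?_)
    simp only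
    rw [← sub_div, potential_sub_potential, energySlope]
    ring
  rw [h4, h2, energy, energy]
  linear_combination 1 / 2 * h1

/-- Supplies both the uniform bound and the pointwise limit for dominated convergence. -/
theorem IsSmoothSolution.continuousOn_energySlope (hΓ : IsClosedSurface Γ)
    (hu : IsSmoothSolution ε b T u) (hT : 0 < T) {t₀ : ℝ} (ht₀ : t₀ ∈ Icc 0 T) :
    ContinuousOn (fun z : ℝ × Γ => energySlope ε b (u z.1) (u t₀) z.2) (Icc 0 T ×ˢ univ) := by
  have hU : ContinuousOn (fun z : ℝ × Γ => u z.1 z.2) (Icc 0 T ×ˢ univ) := hu.smooth.continuousOn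
  have hD := hu.continuousOn_timeDeriv hT
  have hu₀ : ContinuousOn (fun z : ℝ × Γ => u t₀ z.2) (Icc 0 T ×ˢ univ) :=
    ((hu.contMDiff ht₀).continuous.comp continuous_snd).continuousOn
  have hL : ContinuousOn (fun z : ℝ × Γ => laplaceBeltrami (u t₀) z.2) (Icc 0 T ×ˢ univ) :=
    ((continuous_laplaceBeltrami hΓ (hu.contMDiff ht₀)).comp continuous_snd).continuousOn
  have hLt : ContinuousOn (fun z : ℝ × Γ => laplaceBeltrami (u z.1) z.2) (Icc 0 T ×ˢ univ) := by
    have : ContinuousOn (fun z : ℝ × Γ => timeDeriv T u z.1 z.2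
        + 1 / ε ^ 2 * reaction b (u z.1 z.2)) (Icc 0 T ×ˢ univ) := by
      have hr : Continuous (reaction b) := by unfold reaction; fun_prop
      exact hD.add (continuousOn_const.mul (hr.comp_continuousOn hU))
    exact this.congr fun z hz => hu.laplaceBeltrami_eq hz.1 z.2
  have hP : Continuous fun z : ℝ × ℝ => potentialSlope b z.1 z.2 := by
    unfold potentialSlope; fun_prop
  exact (continuousOn_const.mul (hLt.add hL)).add
    ((hP.comp_continuousOn (hU.prodMk hu₀)).div_const _)

/-- The energy dissipation law. -/
theorem IsSmoothSolution.hasDerivWithinAt_energy (hΓ : IsClosedSurface Γ)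
    (hu : IsSmoothSolution ε b T u) (hT : 0 < T) {t₀ : ℝ} (ht₀ : t₀ ∈ Icc 0 T) :
    HasDerivWithinAt (fun s => energy ε b (u s))
      (-∫ p, timeDeriv T u t₀ p ^ 2 ∂(areaMeasure Γ)) (Icc 0 T) t₀ := by
  have : CompactSpace Γ := isCompact_iff_compactSpace.1 hΓ.isCompact
  have := isFiniteMeasure_areaMeasure hΓ
  have hK : IsCompact (Icc 0 T ×ˢ (univ : Set Γ)) := isCompact_Icc.prod isCompact_univ
  have hR := hu.continuousOn_energySlope hΓ hT ht₀
  obtain ⟨M, hM⟩ := hK.exists_bound_of_continuousOn (hu.continuousOn_timeDeriv hT)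
  obtain ⟨N, hN⟩ := hK.exists_bound_of_continuousOn hR
  have hslice {t : ℝ} (ht : t ∈ Icc 0 T) : Continuous (energySlope ε b (u t) (u t₀)) :=
    continuousOn_univ.1 (hR.comp (f := fun p : Γ => (t, p)) (by fun_prop)
      fun p _ => ⟨ht, mem_univ p⟩)
  rw [hasDerivWithinAt_iff_tendsto_slope, ← integral_neg]
  have hev : ∀ᶠ t in nhdsWithin t₀ (Icc 0 T \ {t₀}), t ∈ Icc 0 T \ {t₀} := self_mem_nhdsWithin
  have heq : (fun t => ∫ p, slope (fun s => u s p) t₀ t * energySlope ε b (u t) (u t₀) p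
      ∂(areaMeasure Γ)) =ᶠ[nhdsWithin t₀ (Icc 0 T \ {t₀})]
      slope (fun s => energy ε b (u s)) t₀ := by
    filter_upwards [hev] with t ht
    rw [slope_def_field, energy_sub_energy hΓ (hu.contMDiff ht.1) (hu.contMDiff ht₀),
      ← integral_div]
    refine integral_congr_ae (.of_forall fun p => ?_)
    simp only [slope_def_field]
    ring
  refine Filter.Tendsto.congr' heq ?_
  -- `M` bounds `u_t`, hence the difference quotients of `u` by the mean value inequality; `N`
  -- bounds `energySlope`. Constants are integrable because the area is finite.
  refine tendsto_integral_filter_of_dominated_convergence (fun _ => M * N) ?_ ?_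
    (integrable_const _) (.of_forall fun p => ?_)
  · filter_upwards [hev] with t ht
    refine Continuous.aestronglyMeasurable ?_
    have h1 := (hu.contMDiff ht.1).continuous
    have h2 := (hu.contMDiff ht₀).continuous
    simp only [slope_def_field]
    exact ((h1.sub h2).div_const _).mul (hslice ht.1)
  · filter_upwards [hev] with t ht
    refine .of_forall fun p => ?_
    have h1 : ‖u t p - u t₀ p‖ ≤ M * ‖t - t₀‖ :=
      (convex_Icc 0 T).norm_image_sub_le_of_norm_derivWithin_le (f := fun s => u s p)
        ((hu.contDiffOn_time p).differentiableOn (by simp))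
        (fun s hs => hM (s, p) ⟨hs, mem_univ p⟩) ht₀ ht.1
    have hpos : 0 < ‖t - t₀‖ := norm_pos_iff.2 (sub_ne_zero.2 ht.2)
    have h2 : ‖slope (fun s => u s p) t₀ t‖ ≤ M := by
      rw [slope_def_field, norm_div, div_le_iff₀ hpos]
      exact h1
    rw [norm_mul]
    exact mul_le_mul h2 (hN (t, p) ⟨ht.1, mem_univ p⟩) (norm_nonneg _)
      ((norm_nonneg _).trans h2)
  · have h1 := hasDerivWithinAt_iff_tendsto_slope.1 (hu.hasDerivWithinAt p ht₀)
    have h2 : Filter.Tendsto (fun t => energySlope ε b (u t) (u t₀) p)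
        (nhdsWithin t₀ (Icc 0 T \ {t₀})) (nhds (energySlope ε b (u t₀) (u t₀) p)) := by
      have hc : ContinuousOn (fun t => energySlope ε b (u t) (u t₀) p) (Icc 0 T) :=
        hR.comp (f := fun t : ℝ => (t, p)) (by fun_prop) fun t ht => ⟨ht, mem_univ p⟩
      exact (hc t₀ ht₀).mono_left (nhdsWithin_mono _ sdiff_subset)
    have h3 := h1.mul h2
    rw [hu.energySlope_self ht₀] at h3
    convert h3 using 2
    ring

end Evolution

theorem mainTheorem1 (Γ : Set Space) [ChartedSpace Plane Γ] [IsManifold (𝓡 2) ∞ Γ]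
    (hΓ : IsClosedSurface Γ) (ε b T : ℝ) (hε : 0 < ε) (hT : 0 < T) (u : ℝ → Γ → ℝ)
    (hu : IsSmoothSolution ε b T u) :
    (∀ t ∈ Icc 0 T,
      Integrable (fun p => ‖surfaceGradient (u t) p‖ ^ 2) (areaMeasure Γ) ∧
      Integrable (fun p => potential b (u t p) / ε ^ 2) (areaMeasure Γ) ∧
      Integrable (fun p => timeDeriv T u t p ^ 2) (areaMeasure Γ)) ∧
    (∀ t ∈ Icc 0 T,
      HasDerivWithinAt (fun s => energy ε b (u s))
        (-∫ p, timeDeriv T u t p ^ 2 ∂(areaMeasure Γ)) (Icc 0 T) t ∧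
      -∫ p, timeDeriv T u t p ^ 2 ∂(areaMeasure Γ) ≤ 0) ∧
    AntitoneOn (fun t => energy ε b (u t)) (Icc 0 T) := by
  have hderiv := fun t (ht : t ∈ Icc 0 T) => hu.hasDerivWithinAt_energy hΓ hT ht
  have hnonpos (t : ℝ) : -∫ p, timeDeriv T u t p ^ 2 ∂(areaMeasure Γ) ≤ 0 :=
    neg_nonpos.2 (integral_nonneg fun _ => sq_nonneg _)
  refine ⟨fun t ht => ⟨?_, ?_, ?_⟩, fun t ht => ⟨hderiv t ht, hnonpos t⟩, ?_⟩
  · exact Continuous.integrable_areaMeasure hΓ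
      ((continuous_surfaceGradient hΓ (hu.contMDiff ht)).norm.pow 2)
  · exact (continuous_potential_div ε b (hu.contMDiff ht).continuous).integrable_areaMeasure hΓ
  · have hc : Continuous (timeDeriv T u t) :=
      continuousOn_univ.1 ((hu.continuousOn_timeDeriv hT).comp (f := fun p : Γ => (t, p))
        (by fun_prop) fun p _ => ⟨ht, mem_univ p⟩)
    exact Continuous.integrable_areaMeasure hΓ (hc.pow 2)
  · exact antitoneOn_of_hasDerivWithinAt_nonpos (convex_Icc 0 T)
      (fun t ht => (hderiv t ht).continuousWithinAt)
      (fun t ht => (hderiv t (interior_subset ht)).mono interior_subset)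
      (fun t _ => hnonpos t)
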